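/- Let $V$ be a finite set, $m,n\ge 1$, and let $G=(V,E)$ with $\emptyset\neq E\subseteq V\times V\times\{1,\dots,m\}$ be a strongly connected labelled directed graph, where $(u,v,\sigma)\in E$ is an edge from $u$ to $v$ with label $\sigma$. Let $\mathcal A=\{A_1,\dots,A_m\}\subset\mathbb R^{n\times n}$, let $\|\cdot\|$ be any norm on $\mathbb R^{n\times n}$, and let $d$ be a positive integer. Let $G_k$ be the set of label sequences $s=(\sigma_1,\dots,\sigma_k)$ of the paths of length $k$ in $G$, put $A_s=A_{\sigma_k}\cdots A_{\sigma_1}$, and let $$\rho(G,\mathcal A)=\lim_{k\to\infty}\max_{s\in G_k}\|A_s\|^{1/k}$$ be the constrained joint spectral radius. For any labelled graph $H$, let $H_k$ be the set of label sequences of its paths of length $k$, and let $h(H)=\lim_{k\to\infty}\frac1k\log_2|H_k|$ be the entropy of its language. Let $h(E)=h(G')$ be the entropy of the edge shift $G'$ of $G$: the nodes and the labels of $G'$ are the edges of $G$, and $G'$ has a transition from $(u,v,\sigma)$ to $(v,w,\sigma')$ with label $(v,w,\sigma')$ for all $(u,v,\sigma),(v,w,\sigma')\in E$. Let $\rho_{\mathrm{SOS},2d}$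 be the infimum of the $\gamma\ge 0$ for which there are real homogeneous polynomials $p_v$ $(v\in V)$ of degree $2d$ in $n$ variables such that - $\gamma^{2d}p_u(x)-p_v(A_\sigma x)$ is a sum of squares of polynomials for every $(u,v,\sigma)\in E$, - $p_v$ is a sum of squares of polynomials and $p_v(x)>0$ for all $x\ne 0$, for every $v\in V$, - $\sum_{v\in V}\int_{\mathbb S^{n-1}}p_v(x)\,dx=1$, where $\mathbb S^{n-1}$ is the Euclidean unit sphere with its surface measure. Then both limits $\rho(G,\mathcal A)$ and $h(E)$ exist, the set of such $\gamma$ is nonempty, and $$\max\Big\{\tbinom{n+d-1}{d}^{-\frac1{2d}},\;2^{-\frac{h(E)}{2d}}\Big\}\,\rho_{\mathrm{SOS},2d}\;\le\;\rho(G,\mathcal A)\;\le\;\rho_{\mathrm{SOS},2d}.$$ -/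

import Mathlib

/-- A labelled directed graph with node set `V` and label set `L`, parallel edges with different
labels being allowed: `(u, v, σ) ∈ edges` is an edge from `u` to `v` with label `σ`. -/
structure LabelledGraph (V L : Type*) where
  edges : Set (V × V × L)

namespace LabelledGraph

variable {V L : Type*}

/-- Every node can be reached from every node by a directed path. -/
def StronglyConnected (G : LabelledGraph V L) : Prop :=
  ∀ u v : V, Relation.ReflTransGen (fun a b => ∃ σ, (a, b, σ) ∈ G.edges) u v

/-- `E_k`: the paths of length `k`, as lists of `k` consecutive edges. -/
def paths (G : LabelledGraph V L) (k : ℕ) : Set (List (V × V × L)) :=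
  {s | s.length = k ∧ (∀ e ∈ s, e ∈ G.edges) ∧ s.IsChain (fun e f => e.2.1 = f.1)}

/-- `G_k`: the `G`-admissible words of length `k`, i.e. the label sequences of the paths of
length `k`. -/
def words (G : LabelledGraph V L) (k : ℕ) : Set (List L) :=
  (fun s => s.map (fun e => e.2.2)) '' G.paths k

/-- `(1 / k) log₂ |G_k|`. -/
noncomputable def entropySeq (G : LabelledGraph V L) (k : ℕ) : ℝ :=
  (1 / (k : ℝ)) * Real.logb 2 ((G.words k).ncard : ℝ)

/-- The entropy `h(G) = lim_k (1 / k) log₂ |G_k|` of the language recognized by `G`. -/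
noncomputable def entropy (G : LabelledGraph V L) : ℝ :=
  Filter.limUnder Filter.atTop G.entropySeq

/-- The edge shift of `G`: its nodes and its labels are the edges of `G`, and there is a transition
from `(u, v, σ)` to `(v, w, σ')`, with label `(v, w, σ')`, for any two such edges of `G`. -/
def edgeShift (G : LabelledGraph V L) : LabelledGraph G.edges G.edges where
  edges := {t | t.1.val.2.1 = t.2.1.val.1 ∧ t.2.2 = t.2.1}

end LabelledGraph

namespace CJSR

variable {V : Type*} {m n : ℕ}

/-- `A_s = A_{σ_k} ⋯ A_{σ_1}` for `s = (σ_1, …, σ_k)`. -/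
def wordProd (A : Fin m → Matrix (Fin n) (Fin n) ℝ) (s : List (Fin m)) :
    Matrix (Fin n) (Fin n) ℝ :=
  (s.map A).reverse.prod

/-- `ρ_k(G, A) = max_{s ∈ G_k} ‖A_s‖ ^ (1 / k)`, the norm being `N`. -/
noncomputable def cjsrSeq (N : Seminorm ℝ (Matrix (Fin n) (Fin n) ℝ))
    (G : LabelledGraph V (Fin m)) (A : Fin m → Matrix (Fin n) (Fin n) ℝ) (k : ℕ) : ℝ :=
  sSup ((fun s => N (wordProd A s) ^ (1 / (k : ℝ))) '' G.words k)

/-- The constrained joint spectral radius `ρ(G, A) = lim_k ρ_k(G, A)`. -/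
noncomputable def cjsr (N : Seminorm ℝ (Matrix (Fin n) (Fin n) ℝ))
    (G : LabelledGraph V (Fin m)) (A : Fin m → Matrix (Fin n) (Fin n) ℝ) : ℝ :=
  Filter.limUnder Filter.atTop (cjsrSeq N G A)

/-- The polynomial `p(M x)`. -/
noncomputable def substLinear (M : Matrix (Fin n) (Fin n) ℝ) (p : MvPolynomial (Fin n) ℝ) :
    MvPolynomial (Fin n) ℝ :=
  MvPolynomial.bind₁ (fun i => ∑ j, MvPolynomial.C (M i j) * MvPolynomial.X j) p

/-- The integral of `p` over the Euclidean unit sphere for the surface measure. -/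
noncomputable def sphereIntegral (p : MvPolynomial (Fin n) ℝ) : ℝ :=
  ∫ x : Metric.sphere (0 : EuclideanSpace ℝ (Fin n)) 1,
    MvPolynomial.eval (fun i => x.val i) p
      ∂((MeasureTheory.volume : MeasureTheory.Measure (EuclideanSpace ℝ (Fin n))).toSphere)

/-- Feasibility of `(p, γ)` in the sum of squares program of degree `2 d`. -/
structure SOSFeasible [Fintype V] (G : LabelledGraph V (Fin m))
    (A : Fin m → Matrix (Fin n) (Fin n) ℝ) (d : ℕ)
    (p : V → MvPolynomial (Fin n) ℝ) (γ : ℝ) : Prop where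
  nonneg : 0 ≤ γ
  homogeneous : ∀ v, (p v).IsHomogeneous (2 * d)
  sos_edge : ∀ u v σ, (u, v, σ) ∈ G.edges →
    IsSumSq (MvPolynomial.C (γ ^ (2 * d)) * p u - substLinear (A σ) (p v))
  sos_node : ∀ v, IsSumSq (p v)
  pos : ∀ v, ∀ x : Fin n → ℝ, x ≠ 0 → 0 < MvPolynomial.eval x (p v)
  normalized : ∑ v, sphereIntegral (p v) = 1

/-- The values `γ` for which the sum of squares program of degree `2 d` is feasible. -/
def sosValues [Fintype V] (G : LabelledGraph V (Fin m))
    (A : Fin m → Matrix (Fin n) (Fin n) ℝ) (d : ℕ) : Set ℝ :=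
  {γ | ∃ p : V → MvPolynomial (Fin n) ℝ, SOSFeasible G A d p γ}

/-- `ρ_{SOS,2d}`: the optimal value of the sum of squares program of degree `2 d`. -/
noncomputable def sosBound [Fintype V] (G : LabelledGraph V (Fin m))
    (A : Fin m → Matrix (Fin n) (Fin n) ℝ) (d : ℕ) : ℝ :=
  sInf (sosValues G A d)

end CJSR

open Filter Topology
open scoped Matrix

/-! ### Words, paths and entropy -/

namespace LabelledGraph

variable {V L : Type*}

/-! Upper bound on `ρ`: for a feasible `p` the edge conditions chain along a path of length `k` from
`u` to `v` to `p_v(A_s x) ≤ γ^(2dk) p_u(x)`. A positive definite form of degree `2d` dominates a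
multiple of `‖x‖^(2d)`, so the entries of `A_s` are `O(γ^k)` and `ρ ≤ γ`
(`cjsr_le_of_mem_sosValues`).

Lower bound: let `x^[d]` be the vector of monomials of degree `d` and `M^[d]` the `d`-th symmetric
power, so that `(M x)^[d] = M^[d] x^[d]` and `M ↦ M^[d]` is multiplicative. Positive definite
matrices `Q_v` of size `D = (n+d-1).choose d` with `γ^(2d) Q_u - (A_σ^[d])ᵀ Q_v A_σ^[d] ⪰ 0` on all
edges are Gram matrices of a feasible point, up to normalization (`mem_sosValues_of_posSemidef`).
For `g > ρ` the lifted products are `O(g^(dk))`, and two constructions give such `Q_v`.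

John: the norm at `u`, the supremum of `g^(-dk) ‖A_s^[d] x‖_∞` over walks `s` of any length `k` from
`u`, contracts at rate `g^d` along edges. Replacing each norm by John's ellipsoid costs a factor
`√D` in the rate, hence `γ^(2d) = D g^(2d)`.

Counting: take `∑_{j<K} γ^(-2dj) ∑_s |A_s^[d] x|²`, with `s` over the walks of length `j` from `u`.
Crossing an edge shifts `j` by one; the new term `j = K` is absorbed by the lost term `j = 0` when
`K` is large, because there are at most `2^(hK)` paths for `h > h(E)`. This permits `γ^(2d) = 2^h
g^(2d)`.

The bounds follow as `g ↓ ρ` and `h ↓ h(E)`. Both limits exist by Fekete's lemma. -/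

theorem paths_finite [Finite V] [Finite L] (G : LabelledGraph V L) (k : ℕ) :
    (G.paths k).Finite :=
  (List.finite_length_eq _ k).subset fun _ hs => hs.1

theorem words_finite [Finite V] [Finite L] (G : LabelledGraph V L) (k : ℕ) :
    (G.words k).Finite :=
  (G.paths_finite k).image _

/-- A word of length `k + l` splits into a word of length `k` and a word of length `l`. -/
theorem exists_append_of_mem_words_add (G : LabelledGraph V L) {k l : ℕ} {w : List L}
    (hw : w ∈ G.words (k + l)) : ∃ w₁ ∈ G.words k, ∃ w₂ ∈ G.words l, w = w₁ ++ w₂ := by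
  obtain ⟨s, ⟨hlen, hmem, hch⟩, rfl⟩ := hw
  refine ⟨_, ⟨s.take k, ⟨by simp [hlen], fun e he => hmem e (List.mem_of_mem_take he),
    hch.take k⟩, rfl⟩, _, ⟨s.drop k, ⟨by simp [hlen], fun e he => hmem e (List.mem_of_mem_drop he),
    hch.drop k⟩, rfl⟩, ?_⟩
  simp only
  rw [← List.map_append, List.take_append_drop]

theorem ncard_words_add_le [Finite V] [Finite L] (G : LabelledGraph V L) (k l : ℕ) :
    (G.words (k + l)).ncard ≤ (G.words k).ncard * (G.words l).ncard := by
  have hfin := (G.words_finite k).prod (G.words_finite l)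
  rw [← Set.ncard_prod]
  refine (Set.ncard_le_ncard (t := (fun p : List L × List L => p.1 ++ p.2) ''
    (G.words k ×ˢ G.words l)) ?_ (hfin.image _)).trans (Set.ncard_image_le hfin)
  intro w hw
  obtain ⟨w₁, h₁, w₂, h₂, rfl⟩ := G.exists_append_of_mem_words_add hw
  exact ⟨(w₁, w₂), ⟨h₁, h₂⟩, rfl⟩

theorem subadditive_logb_ncard_words [Finite V] [Finite L] (G : LabelledGraph V L) :
    Subadditive fun k => Real.logb 2 ((G.words k).ncard : ℝ) := by
  have h0 : ∀ j : ℕ, 0 ≤ Real.logb 2 (j : ℝ) := fun j => by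
    unfold Real.logb
    exact div_nonneg (Real.log_natCast_nonneg j) (Real.log_nonneg (by norm_num))
  intro k l
  -- Without words of length `k + l` the left side is `logb 2 0 = 0`, by the default value of the
  -- logarithm.
  rcases Nat.eq_zero_or_pos (G.words (k + l)).ncard with h | h
  · simpa [h] using add_nonneg (h0 (G.words k).ncard) (h0 (G.words l).ncard)
  · have hle := G.ncard_words_add_le k l
    have hk : (G.words k).ncard ≠ 0 := by rintro hk; rw [hk] at hle; omega
    have hl : (G.words l).ncard ≠ 0 := by rintro hl; rw [hl] at hle; omega
    rw [← Real.logb_mul (by exact_mod_cast hk) (by exact_mod_cast hl)]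
    exact Real.logb_le_logb_of_le (by norm_num) (by exact_mod_cast h) (by exact_mod_cast hle)

/-- The entropy of the language of a finite labelled graph exists as a limit. -/
theorem tendsto_entropySeq [Finite V] [Finite L] (G : LabelledGraph V L) :
    Filter.Tendsto G.entropySeq Filter.atTop (nhds G.entropy) := by
  have h0 : ∀ j : ℕ, 0 ≤ Real.logb 2 (j : ℝ) := fun j => by
    unfold Real.logb
    exact div_nonneg (Real.log_natCast_nonneg j) (Real.log_nonneg (by norm_num))
  have h := G.subadditive_logb_ncard_words.tendsto_lim
    ⟨0, by rintro _ ⟨k, rfl⟩; exact div_nonneg (h0 _) (Nat.cast_nonneg k)⟩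
  have h' : Filter.Tendsto G.entropySeq Filter.atTop
      (nhds G.subadditive_logb_ncard_words.lim) := by
    refine h.congr fun k => ?_
    simp only [entropySeq]
    ring
  exact tendsto_nhds_limUnder ⟨_, h'⟩

/-- The paths of `G` that start at the node `u`. -/
def walks (G : LabelledGraph V L) (u : V) : Set (List (V × V × L)) :=
  {s | (∀ e ∈ s, e ∈ G.edges) ∧ s.IsChain (fun e f => e.2.1 = f.1) ∧ ∀ e ∈ s.head?, u = e.1}

theorem nil_mem_walks (G : LabelledGraph V L) (u : V) : [] ∈ G.walks u := by simp [walks]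

theorem cons_mem_walks (G : LabelledGraph V L) {u : V} {e : V × V × L} {s : List (V × V × L)} :
    e :: s ∈ G.walks u ↔ e ∈ G.edges ∧ u = e.1 ∧ s ∈ G.walks e.2.1 := by
  simp only [walks, Set.mem_ofPred_eq, List.isChain_cons, List.mem_cons, forall_eq_or_imp,
    List.head?_cons, Option.mem_some_iff, forall_eq']
  tauto

theorem mem_paths_of_mem_walks (G : LabelledGraph V L) {u : V} {s : List (V × V × L)}
    (hs : s ∈ G.walks u) : s ∈ G.paths s.length :=
  ⟨rfl, hs.1, hs.2.1⟩

theorem map_label_mem_words (G : LabelledGraph V L) {u : V} {s : List (V × V × L)}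
    (hs : s ∈ G.walks u) : s.map (fun e => e.2.2) ∈ G.words s.length :=
  ⟨s, G.mem_paths_of_mem_walks hs, rfl⟩

theorem exists_mem_walks_of_mem_words [Nonempty V] (G : LabelledGraph V L) {k : ℕ} {w : List L}
    (hw : w ∈ G.words k) :
    ∃ u, ∃ s ∈ G.walks u, s.length = k ∧ s.map (fun e => e.2.2) = w := by
  obtain ⟨s, ⟨hlen, hmem, hch⟩, rfl⟩ := hw
  cases s with
  | nil => exact ⟨Classical.arbitrary V, [], G.nil_mem_walks _, hlen, rfl⟩
  | cons e s => exact ⟨e.1, e :: s, ⟨hmem, hch, by simp⟩, hlen, rfl⟩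

/-- In a strongly connected graph with an edge, every node has an incoming edge. -/
theorem StronglyConnected.exists_edge_into {G : LabelledGraph V L} (hG : G.StronglyConnected)
    (hE : G.edges.Nonempty) (v : V) : ∃ e ∈ G.edges, e.2.1 = v := by
  obtain ⟨⟨a, b, σ⟩, he⟩ := hE
  rcases Relation.ReflTransGen.cases_tail (hG b v) with rfl | ⟨c, _, τ, hc⟩
  · exact ⟨_, he, rfl⟩
  · exact ⟨_, hc, rfl⟩

/-- A walk continuing the edge `e` is the label sequence of a walk of the edge shift. -/
theorem exists_edgeShift_walk (G : LabelledGraph V L) (s : List (V × V × L)) :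
    ∀ e : G.edges, s ∈ G.walks e.val.2.1 →
      ∃ t ∈ G.edgeShift.walks e, t.map (fun f => f.2.2.val) = s := by
  induction s with
  | nil => exact fun e _ => ⟨[], nil_mem_walks _ _, rfl⟩
  | cons f s ih =>
    intro e hs
    obtain ⟨hf, hef, hs⟩ := G.cons_mem_walks.1 hs
    obtain ⟨t, ht, hts⟩ := ih ⟨f, hf⟩ hs
    refine ⟨(e, ⟨f, hf⟩, ⟨f, hf⟩) :: t, (cons_mem_walks _).2 ⟨⟨hef, rfl⟩, rfl, ht⟩, ?_⟩
    simp [hts]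

/-- The paths of a strongly connected graph are admissible words of its edge shift. -/
theorem ncard_paths_le_ncard_words_edgeShift [Finite V] [Finite L] {G : LabelledGraph V L}
    (hG : G.StronglyConnected) (hE : G.edges.Nonempty) (k : ℕ) :
    (G.paths k).ncard ≤ (G.edgeShift.words k).ncard := by
  have hfin := G.edgeShift.words_finite k
  refine (Set.ncard_le_ncard (t := List.map Subtype.val '' G.edgeShift.words k) ?_
    (hfin.image _)).trans (Set.ncard_image_le hfin)
  rintro s ⟨hlen, hmem, hch⟩
  obtain ⟨e₀, he₀⟩ := hE
  -- A transition of the edge shift records only the edge it enters, so reading `k` edges needs an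
  -- extra edge to start from. Strong connectivity supplies one.
  obtain ⟨e, he, hs⟩ : ∃ e ∈ G.edges, s ∈ G.walks e.2.1 := by
    cases s with
    | nil => exact ⟨e₀, he₀, G.nil_mem_walks _⟩
    | cons f s =>
      obtain ⟨e, he, hef⟩ := hG.exists_edge_into ⟨e₀, he₀⟩ f.1
      exact ⟨e, he, hmem, hch, by simp [hef]⟩
  obtain ⟨t, ht, hts⟩ := G.exists_edgeShift_walk s ⟨e, he⟩ hs
  have htlen : t.length = k := by rw [← hlen, ← hts, List.length_map]
  refine ⟨_, htlen ▸ G.edgeShift.map_label_mem_words ht, ?_⟩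
  rw [← hts, List.map_map]
  rfl

/-- The number of paths grows at most like `c ^ k` for every `c` above `2 ^ h(E)`. -/
theorem eventually_ncard_paths_le [Finite V] [Finite L] {G : LabelledGraph V L}
    (hG : G.StronglyConnected) (hE : G.edges.Nonempty) {h : ℝ} (hh : G.edgeShift.entropy < h) :
    ∀ᶠ k : ℕ in Filter.atTop, ((G.paths k).ncard : ℝ) ≤ ((2 : ℝ) ^ h) ^ k := by
  filter_upwards [G.edgeShift.tendsto_entropySeq.eventually (eventually_lt_nhds hh),
    Filter.eventually_gt_atTop 0] with k hk hk0
  have hk0' : (0 : ℝ) < k := by exact_mod_cast hk0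
  rcases Nat.eq_zero_or_pos (G.paths k).ncard with h0 | h0
  · rw [h0]; simp only [Nat.cast_zero]; positivity
  · have hle := ncard_paths_le_ncard_words_edgeShift hG hE k
    have hpos : (0 : ℝ) < ((G.edgeShift.words k).ncard : ℝ) := by exact_mod_cast h0.trans_le hle
    have hlog : Real.logb 2 ((G.edgeShift.words k).ncard : ℝ) < h * k := by
      rw [entropySeq, one_div, inv_mul_lt_iff₀ hk0'] at hk
      linarith
    rw [← Real.rpow_natCast, ← Real.rpow_mul (by norm_num)]
    have hle' : ((G.paths k).ncard : ℝ) ≤ ((G.edgeShift.words k).ncard : ℝ) := by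
      exact_mod_cast hle
    exact hle'.trans ((Real.logb_lt_iff_lt_rpow (by norm_num) hpos).1 hlog).le

end LabelledGraph

/-! ### Limits of `k`-th roots and comparison of norms -/

theorem tendsto_const_rpow_one_div {c : ℝ} (hc : 0 < c) :
    Tendsto (fun k : ℕ => c ^ (1 / (k : ℝ))) atTop (𝓝 1) := by
  have h := (Real.continuousAt_const_rpow (b := 0) hc.ne').tendsto.comp
    tendsto_one_div_atTop_nhds_zero_nat
  simpa [Function.comp_def] using h

/-- Fekete's lemma in multiplicative form, without a lower bound on the sequence. -/
theorem exists_tendsto_rpow_one_div_of_submultiplicative {a : ℕ → ℝ} (ha : ∀ k, 0 ≤ a k)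
    (hmul : ∀ k l, a (k + l) ≤ a k * a l) :
    ∃ L, Tendsto (fun k : ℕ => a k ^ (1 / (k : ℝ))) atTop (𝓝 L) := by
  -- The logarithm of `a k` may be undefined, or too negative for Fekete's lemma. Truncating from
  -- below by the multiplicative sequence `δ ^ k` preserves submultiplicativity and bounds `log (b
  -- k) / k` by `log δ`.
  have key : ∀ δ : ℝ, 0 < δ →
      ∃ L, Tendsto (fun k : ℕ => max (a k ^ (1 / (k : ℝ))) δ) atTop (𝓝 L) := by
    intro δ hδ
    set b : ℕ → ℝ := fun k => max (a k) (δ ^ k) with hb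
    have hbpos : ∀ k, 0 < b k := fun k => lt_max_of_lt_right (pow_pos hδ k)
    have hsub : Subadditive fun k => Real.log (b k) := by
      intro k l
      rw [← Real.log_mul (hbpos k).ne' (hbpos l).ne']
      refine Real.log_le_log (hbpos _) (max_le ?_ ?_)
      · exact (hmul k l).trans
          (mul_le_mul (le_max_left _ _) (le_max_left _ _) (ha l) (hbpos k).le)
      · rw [pow_add]
        exact mul_le_mul (le_max_right _ _) (le_max_right _ _) (by positivity) (hbpos k).le
    -- The `0` in the minimum serves `k = 0`, where the quotient is `0` by convention.
    have hlim := hsub.tendsto_lim ⟨min 0 (Real.log δ), by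
      rintro _ ⟨k, rfl⟩
      rcases Nat.eq_zero_or_pos k with rfl | hk
      · simp
      · refine (min_le_right _ _).trans ?_
        have hk' : (0 : ℝ) < k := by exact_mod_cast hk
        rw [le_div_iff₀ hk', mul_comm, ← Real.log_pow]
        exact Real.log_le_log (by positivity) (le_max_right _ _)⟩
    refine ⟨_, ((Real.continuous_exp.tendsto _).comp hlim).congr' ?_⟩
    filter_upwards [eventually_gt_atTop 0] with k hk
    have hk' : (0 : ℝ) < 1 / (k : ℝ) := by positivity
    have hδk : (δ ^ k) ^ (1 / (k : ℝ)) = δ := by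
      rw [one_div]; exact Real.pow_rpow_inv_natCast hδ.le hk.ne'
    simp only [Function.comp]
    rw [div_eq_mul_one_div, ← Real.rpow_def_of_pos (hbpos k), hb]
    simp only
    rw [(Real.monotoneOn_rpow_Ici_of_exponent_nonneg hk'.le).map_max (ha k)
      (show (0 : ℝ) ≤ δ ^ k by positivity), hδk]
  choose! L hL using key
  -- If some limit exceeds its `δ`, that truncation is eventually inactive. Otherwise the roots are
  -- eventually below every `ε`, and the limit is `0`.
  by_cases h : ∃ δ, 0 < δ ∧ δ < L δ
  · obtain ⟨δ, hδ, hlt⟩ := h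
    refine ⟨L δ, (hL δ hδ).congr' ?_⟩
    filter_upwards [(hL δ hδ).eventually (eventually_gt_nhds hlt)] with k hk
    rcases lt_max_iff.1 hk with h | h
    · exact max_eq_left h.le
    · exact absurd h (lt_irrefl _)
  · push Not at h
    refine ⟨0, Metric.tendsto_atTop.2 fun ε hε => ?_⟩
    have hev := (hL (ε / 2) (half_pos hε)).eventually
      (eventually_lt_nhds ((h _ (half_pos hε)).trans_lt (half_lt_self hε)))
    obtain ⟨K, hK⟩ := eventually_atTop.1 hev
    refine ⟨K, fun k hk => ?_⟩
    rw [Real.dist_0_eq_abs, abs_of_nonneg (Real.rpow_nonneg (ha k) _)]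
    exact (le_max_left _ _).trans_lt (hK k hk)

theorem sSup_image_rpow {α : Type*} {S : Set α} (hS : S.Finite) {f : α → ℝ}
    (hf : ∀ s ∈ S, 0 ≤ f s) {r : ℝ} (hr : 0 < r) :
    sSup ((fun s => f s ^ r) '' S) = sSup (f '' S) ^ r := by
  rcases S.eq_empty_or_nonempty with rfl | hne
  · simp [Real.zero_rpow hr.ne']
  · obtain ⟨s, hs, hmax⟩ := Set.exists_max_image S f hS hne
    have h1 : IsGreatest (f '' S) (f s) :=
      ⟨⟨s, hs, rfl⟩, by rintro _ ⟨t, ht, rfl⟩; exact hmax t ht⟩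
    have h2 : IsGreatest ((fun s => f s ^ r) '' S) (f s ^ r) :=
      ⟨⟨s, hs, rfl⟩, by
        rintro _ ⟨t, ht, rfl⟩; exact Real.rpow_le_rpow (hf t ht) (hmax t ht) hr.le⟩
    rw [h1.csSup_eq, h2.csSup_eq]

/-- A linear functional on a finite-dimensional space is bounded by every norm. -/
theorem Seminorm.exists_abs_le_mul {E : Type*} [AddCommGroup E] [Module ℝ E]
    [FiniteDimensional ℝ E] (N : Seminorm ℝ E) (hN : ∀ x, N x = 0 → x = 0) (f : E →ₗ[ℝ] ℝ) :
    ∃ C, 0 < C ∧ ∀ x, |f x| ≤ C * N x := by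
  let g : AddGroupNorm E :=
    { N.toAddGroupSeminorm with eq_zero_of_map_eq_zero' := hN }
  let : NormedAddCommGroup E := g.toNormedAddCommGroup
  let : NormedSpace ℝ E := ⟨fun a x => (map_smul_eq_mul N a x).le⟩
  refine ⟨‖LinearMap.toContinuousLinearMap f‖ + 1, by positivity, fun x => ?_⟩
  have h := (LinearMap.toContinuousLinearMap f).le_opNorm x
  have h2 : (0 : ℝ) ≤ ‖x‖ := norm_nonneg x
  calc |f x| ≤ ‖LinearMap.toContinuousLinearMap f‖ * ‖x‖ := h
    _ ≤ (‖LinearMap.toContinuousLinearMap f‖ + 1) * ‖x‖ := by nlinarith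

/-! ### Existence and growth characterization of the constrained joint spectral radius -/

namespace CJSR

variable {V : Type*} {m n : ℕ}

/-- One half of the equivalence of `N` with the largest entry; the next lemma is the other half and
needs no definiteness. The summand `1` keeps the constant positive when `n = 0`. -/
theorem exists_abs_entry_le (N : Seminorm ℝ (Matrix (Fin n) (Fin n) ℝ))
    (hN : ∀ M, N M = 0 → M = 0) : ∃ C, 0 < C ∧ ∀ M i j, |M i j| ≤ C * N M := by
  choose C hC h using fun p : Fin n × Fin n =>
    N.exists_abs_le_mul hN (Matrix.entryLinearMap ℝ ℝ p.1 p.2)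
  refine ⟨∑ p, C p + 1, by have := Finset.sum_nonneg fun p (_ : p ∈ Finset.univ) => (hC p).le
                           linarith, fun M i j => (h (i, j) M).trans ?_⟩
  refine mul_le_mul_of_nonneg_right ?_ (apply_nonneg N M)
  have := Finset.single_le_sum (fun p _ => (hC p).le) (Finset.mem_univ (i, j))
  linarith

theorem exists_le_of_abs_entry_le (N : Seminorm ℝ (Matrix (Fin n) (Fin n) ℝ)) :
    ∃ C, 0 < C ∧ ∀ M c, (∀ i j, |M i j| ≤ c) → 0 ≤ c → N M ≤ C * c := by
  refine ⟨∑ i, ∑ j, N (Matrix.single i j 1) + 1, ?_, fun M c hM hc => ?_⟩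
  · have : 0 ≤ ∑ i : Fin n, ∑ j : Fin n, N (Matrix.single i j 1) :=
      Finset.sum_nonneg fun i _ => Finset.sum_nonneg fun j _ => apply_nonneg N _
    linarith
  · have hsum : ∀ (ι : Type) (s : Finset ι) (f : ι → Matrix (Fin n) (Fin n) ℝ),
        N (∑ i ∈ s, f i) ≤ ∑ i ∈ s, N (f i) := fun ι s f =>
      Finset.le_sum_of_subadditive N (map_zero N).le (map_add_le_add N) s f
    calc N M = N (∑ i, ∑ j, Matrix.single i j (M i j)) := by
          rw [← Matrix.matrix_eq_sum_single M]
      _ ≤ ∑ i, ∑ j, N (Matrix.single i j (M i j)) :=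
          (hsum _ _ _).trans (Finset.sum_le_sum fun i _ => hsum _ _ _)
      _ ≤ ∑ i, ∑ j, N (Matrix.single i j 1) * c := by
          refine Finset.sum_le_sum fun i _ => Finset.sum_le_sum fun j _ => ?_
          have : Matrix.single i j (M i j) = M i j • Matrix.single i j (1 : ℝ) := by
            rw [Matrix.smul_single, smul_eq_mul, mul_one]
          rw [this, map_smul_eq_mul, mul_comm, Real.norm_eq_abs]
          exact mul_le_mul_of_nonneg_left (hM i j) (apply_nonneg N _)
      _ = (∑ i, ∑ j, N (Matrix.single i j 1)) * c := by simp_rw [Finset.sum_mul]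
      _ ≤ _ := by nlinarith

/-- An arbitrary norm need not be submultiplicative, but it is so up to a constant, by comparison
with the entries. Then `C * N` is submultiplicative, and `C ^ (1 / k) → 1` makes the factor
harmless. -/
theorem exists_submultiplicative (N : Seminorm ℝ (Matrix (Fin n) (Fin n) ℝ))
    (hN : ∀ M, N M = 0 → M = 0) : ∃ C, 0 < C ∧ ∀ M M', N (M * M') ≤ C * N M * N M' := by
  obtain ⟨C₁, hC₁, h₁⟩ := exists_abs_entry_le N hN
  obtain ⟨C₂, hC₂, h₂⟩ := exists_le_of_abs_entry_le N
  refine ⟨C₂ * ((n + 1) * (C₁ * C₁)), by positivity, fun M M' => ?_⟩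
  have h0 := apply_nonneg N M
  have h0' := apply_nonneg N M'
  refine (h₂ (M * M') ((n + 1) * ((C₁ * N M) * (C₁ * N M'))) (fun i j => ?_)
    (by positivity)).trans (le_of_eq (by ring))
  rw [Matrix.mul_apply]
  calc |∑ k, M i k * M' k j| ≤ ∑ k, |M i k * M' k j| := Finset.abs_sum_le_sum_abs _ _
    _ ≤ ∑ _k : Fin n, (C₁ * N M) * (C₁ * N M') := by
        refine Finset.sum_le_sum fun k _ => ?_
        rw [abs_mul]
        exact mul_le_mul (h₁ _ _ _) (h₁ _ _ _) (abs_nonneg _) (by positivity)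
    _ = n * ((C₁ * N M) * (C₁ * N M')) := by simp
    _ ≤ _ := by
        have : 0 ≤ (C₁ * N M) * (C₁ * N M') := by positivity
        nlinarith

theorem wordProd_append (A : Fin m → Matrix (Fin n) (Fin n) ℝ) (w₁ w₂ : List (Fin m)) :
    wordProd A (w₁ ++ w₂) = wordProd A w₂ * wordProd A w₁ := by
  simp [wordProd]

variable (N : Seminorm ℝ (Matrix (Fin n) (Fin n) ℝ)) (G : LabelledGraph V (Fin m))
  (A : Fin m → Matrix (Fin n) (Fin n) ℝ)

theorem cjsrSeq_eq [Finite V] {k : ℕ} (hk : 0 < k) :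
    cjsrSeq N G A k = sSup ((fun s => N (wordProd A s)) '' G.words k) ^ (1 / (k : ℝ)) :=
  sSup_image_rpow (G.words_finite k) (fun _ _ => apply_nonneg N _) (by positivity)

theorem le_sSup_words [Finite V] {k : ℕ} {w : List (Fin m)} (hw : w ∈ G.words k) :
    N (wordProd A w) ≤ sSup ((fun s => N (wordProd A s)) '' G.words k) :=
  le_csSup ((G.words_finite k).image _).bddAbove ⟨w, hw, rfl⟩

theorem sSup_words_nonneg (k : ℕ) : 0 ≤ sSup ((fun s => N (wordProd A s)) '' G.words k) :=
  Real.sSup_nonneg (by rintro _ ⟨w, _, rfl⟩; exact apply_nonneg N _)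

/-- The limit defining the constrained joint spectral radius exists. -/
theorem tendsto_cjsrSeq [Finite V] (hN : ∀ M, N M = 0 → M = 0) :
    Tendsto (cjsrSeq N G A) atTop (𝓝 (cjsr N G A)) := by
  refine tendsto_nhds_limUnder ?_
  obtain ⟨C, hC, hmul⟩ := exists_submultiplicative N hN
  set S : ℕ → ℝ := fun k => sSup ((fun s => N (wordProd A s)) '' G.words k)
  have hS : ∀ k, 0 ≤ S k := sSup_words_nonneg N G A
  obtain ⟨L, hL⟩ := exists_tendsto_rpow_one_div_of_submultiplicative (a := fun k => C * S k)
    (fun k => mul_nonneg hC.le (hS k)) (fun k l => by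
      have : S (k + l) ≤ C * S k * S l := by
        refine Real.sSup_le ?_ (mul_nonneg (mul_nonneg hC.le (hS k)) (hS l))
        rintro _ ⟨w, hw, rfl⟩
        obtain ⟨w₁, h₁, w₂, h₂, rfl⟩ := G.exists_append_of_mem_words_add hw
        simp only
        rw [wordProd_append]
        refine (hmul _ _).trans ?_
        rw [mul_right_comm]
        exact mul_le_mul (mul_le_mul_of_nonneg_left (le_sSup_words N G A h₁) hC.le)
          (le_sSup_words N G A h₂) (apply_nonneg N _) (mul_nonneg hC.le (hS k))
      calc C * S (k + l) ≤ C * (C * S k * S l) := mul_le_mul_of_nonneg_left this hC.le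
        _ = C * S k * (C * S l) := by ring)
  refine ⟨L * 1, (hL.mul (tendsto_const_rpow_one_div (inv_pos.2 hC))).congr' ?_⟩
  filter_upwards [eventually_gt_atTop 0] with k hk
  rw [cjsrSeq_eq N G A hk, ← Real.mul_rpow (mul_nonneg hC.le (hS k)) (inv_pos.2 hC).le]
  congr 1
  field_simp
  rfl

theorem cjsr_nonneg [Finite V] (hN : ∀ M, N M = 0 → M = 0) : 0 ≤ cjsr N G A :=
  ge_of_tendsto' (tendsto_cjsrSeq N G A hN) fun k =>
    Real.sSup_nonneg (by rintro _ ⟨w, _, rfl⟩; exact Real.rpow_nonneg (apply_nonneg N _) _)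

/-- The products along admissible words grow at most like `g ^ k` for every `g` above the
constrained joint spectral radius. -/
theorem exists_abs_entry_wordProd_le [Finite V] (hN : ∀ M, N M = 0 → M = 0) {g : ℝ}
    (hg : cjsr N G A < g) :
    ∃ C, 0 < C ∧ ∀ k, ∀ w ∈ G.words k, ∀ i j, |wordProd A w i j| ≤ C * g ^ k := by
  have hg0 : 0 < g := (cjsr_nonneg N G A hN).trans_lt hg
  set S : ℕ → ℝ := fun k => sSup ((fun s => N (wordProd A s)) '' G.words k)
  have hev : ∀ᶠ k in atTop, S k / g ^ k ≤ 1 := by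
    filter_upwards [(tendsto_cjsrSeq N G A hN).eventually (eventually_lt_nhds hg),
      eventually_gt_atTop 0] with k hk hk0
    rw [cjsrSeq_eq N G A hk0, one_div] at hk
    rw [div_le_one (by positivity)]
    exact ((Real.rpow_inv_lt_iff_of_pos (sSup_words_nonneg N G A k) hg0.le
      (by exact_mod_cast hk0)).1 hk).le.trans_eq (Real.rpow_natCast _ _)
  -- An eventual bound on a sequence gives a bound for all `k`, including the finitely many early
  -- ones.
  obtain ⟨B, hB⟩ := (isBoundedUnder_of_eventually_le hev).bddAbove_range
  obtain ⟨C, hC, hent⟩ := exists_abs_entry_le N hN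
  refine ⟨C * (|B| + 1), by positivity, fun k w hw i j => (hent _ i j).trans ?_⟩
  have h1 : S k / g ^ k ≤ B := hB ⟨k, rfl⟩
  rw [div_le_iff₀ (by positivity)] at h1
  rw [mul_assoc]
  refine mul_le_mul_of_nonneg_left ((le_sSup_words N G A hw).trans (h1.trans ?_)) hC.le
  exact mul_le_mul_of_nonneg_right (by linarith [le_abs_self B]) (by positivity)

/-- The `k`-th root sends every constant factor to `1`, so entrywise growth suffices whatever the
norm. -/
theorem cjsr_le_of_forall_abs_entry_le [Finite V] (hN : ∀ M, N M = 0 → M = 0) {C g : ℝ}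
    (hC : 0 < C) (hg : 0 ≤ g)
    (h : ∀ k, ∀ w ∈ G.words k, ∀ i j, |wordProd A w i j| ≤ C * g ^ k) : cjsr N G A ≤ g := by
  obtain ⟨C', hC', hle⟩ := exists_le_of_abs_entry_le N
  have hlim : Tendsto (fun k : ℕ => (C' * C) ^ (1 / (k : ℝ)) * g) atTop (𝓝 (1 * g)) :=
    (tendsto_const_rpow_one_div (by positivity)).mul_const g
  rw [one_mul] at hlim
  refine le_of_tendsto_of_tendsto (tendsto_cjsrSeq N G A hN) hlim ?_
  filter_upwards [eventually_gt_atTop 0] with k hk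
  refine Real.sSup_le ?_ (by positivity)
  rintro _ ⟨w, hw, rfl⟩
  have h1 : N (wordProd A w) ≤ C' * C * g ^ k := by
    rw [mul_assoc]
    exact hle _ _ (h k w hw) (by positivity)
  calc N (wordProd A w) ^ (1 / (k : ℝ)) ≤ (C' * C * g ^ k) ^ (1 / (k : ℝ)) :=
        Real.rpow_le_rpow (apply_nonneg N _) h1 (by positivity)
    _ = _ := by
        rw [Real.mul_rpow (by positivity) (by positivity), one_div,
          Real.pow_rpow_inv_natCast hg hk.ne']

end CJSR

/-! ### Quadratic forms and John's ellipsoid -/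

namespace Matrix

variable {ι : Type*} [Fintype ι]

theorem dotProduct_mulVec_smul_self (Q : Matrix ι ι ℝ) (c : ℝ) (x : ι → ℝ) :
    (c • x) ⬝ᵥ Q *ᵥ (c • x) = c ^ 2 * (x ⬝ᵥ Q *ᵥ x) := by
  rw [mulVec_smul, smul_dotProduct, dotProduct_smul, smul_eq_mul, smul_eq_mul]
  ring

theorem dotProduct_vecMulVec_mulVec (w x : ι → ℝ) :
    x ⬝ᵥ vecMulVec w w *ᵥ x = (w ⬝ᵥ x) ^ 2 := by
  rw [vecMulVec_mulVec, op_smul_eq_smul, dotProduct_smul, smul_eq_mul, dotProduct_comm x w]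
  ring

theorem IsSymm.dotProduct_mulVec_comm {Q : Matrix ι ι ℝ} (hQ : Q.IsSymm) (x y : ι → ℝ) :
    x ⬝ᵥ Q *ᵥ y = y ⬝ᵥ Q *ᵥ x := by
  rw [dotProduct_mulVec, ← mulVec_transpose, hQ.eq, dotProduct_comm]

theorem posSemidef_of_isSymm {Q : Matrix ι ι ℝ} (hQ : Q.IsSymm) (h : ∀ x, 0 ≤ x ⬝ᵥ Q *ᵥ x) :
    Q.PosSemidef :=
  .of_dotProduct_mulVec_nonneg (by rwa [IsHermitian, conjTranspose_eq_transpose_of_trivial])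
    (by simpa using h)

theorem posDef_of_isSymm {Q : Matrix ι ι ℝ} (hQ : Q.IsSymm) (h : ∀ x, x ≠ 0 → 0 < x ⬝ᵥ Q *ᵥ x) :
    Q.PosDef :=
  .of_dotProduct_mulVec_pos (by rwa [IsHermitian, conjTranspose_eq_transpose_of_trivial])
    (by simpa using h)

theorem PosSemidef.isSymm {κ : Type*} {Q : Matrix κ κ ℝ} (hQ : Q.PosSemidef) : Q.IsSymm := by
  have := hQ.isHermitian
  rwa [IsHermitian, conjTranspose_eq_transpose_of_trivial] at this

theorem PosSemidef.quad_nonneg {Q : Matrix ι ι ℝ} (hQ : Q.PosSemidef) (x : ι → ℝ) :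
    0 ≤ x ⬝ᵥ Q *ᵥ x := by simpa using hQ.dotProduct_mulVec_nonneg x

theorem PosDef.quad_pos {Q : Matrix ι ι ℝ} (hQ : Q.PosDef) {x : ι → ℝ} (hx : x ≠ 0) :
    0 < x ⬝ᵥ Q *ᵥ x := by simpa using hQ.dotProduct_mulVec_pos hx

/-- Cauchy-Schwarz for a positive definite form and its dual form. -/
theorem PosDef.dotProduct_sq_le [DecidableEq ι] {Q : Matrix ι ι ℝ} (hQ : Q.PosDef)
    (w x : ι → ℝ) : (w ⬝ᵥ x) ^ 2 ≤ (w ⬝ᵥ Q⁻¹ *ᵥ w) * (x ⬝ᵥ Q *ᵥ x) := by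
  have hu : IsUnit Q.det := (isUnit_iff_isUnit_det Q).1 hQ.isUnit
  have hs := hQ.posSemidef.isSymm
  set y := Q⁻¹ *ᵥ w with hy
  have hQy : Q *ᵥ y = w := by rw [hy, mulVec_mulVec, mul_nonsing_inv _ hu, one_mulVec]
  -- This is the form at `x + t • y`; a nonnegative quadratic in `t` has nonpositive discriminant.
  have key : ∀ t : ℝ, 0 ≤ (w ⬝ᵥ y) * (t * t) + 2 * (w ⬝ᵥ x) * t + x ⬝ᵥ Q *ᵥ x := by
    intro t
    have h := hQ.posSemidef.quad_nonneg (x + t • y)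
    rw [mulVec_add, mulVec_smul, hQy, add_dotProduct, dotProduct_add, dotProduct_add,
      smul_dotProduct, smul_dotProduct, dotProduct_smul, dotProduct_smul,
      hs.dotProduct_mulVec_comm y x, hQy, dotProduct_comm x w, dotProduct_comm y w] at h
    simp only [smul_eq_mul] at h
    linarith
  have := discrim_le_zero key
  rw [discrim] at this
  nlinarith

theorem posSemidef_smul_sub_of_forall_le {Q Q' B : Matrix ι ι ℝ} (hQ : Q.IsSymm)
    (hQ' : Q'.IsSymm) {c : ℝ} (h : ∀ x, (B *ᵥ x) ⬝ᵥ Q' *ᵥ (B *ᵥ x) ≤ c * (x ⬝ᵥ Q *ᵥ x)) :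
    (c • Q - Bᵀ * Q' * B).PosSemidef := by
  refine posSemidef_of_isSymm ?_ fun x => ?_
  · rw [Matrix.IsSymm, Matrix.transpose_sub, Matrix.transpose_smul, hQ.eq, Matrix.transpose_mul,
      Matrix.transpose_mul, Matrix.transpose_transpose, hQ'.eq, Matrix.mul_assoc]
  · rw [Matrix.sub_mulVec, Matrix.smul_mulVec, dotProduct_sub, dotProduct_smul, smul_eq_mul,
      ← Matrix.mulVec_mulVec, ← Matrix.mulVec_mulVec, Matrix.dotProduct_mulVec x Bᵀ,
      Matrix.vecMul_transpose]
    exact sub_nonneg.2 (h x)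


theorem mulVec_dotProduct_self_le {M : Matrix ι ι ℝ} {c : ℝ} (hM : ∀ i j, |M i j| ≤ c)
    (x : ι → ℝ) : (M *ᵥ x) ⬝ᵥ (M *ᵥ x) ≤ (Fintype.card ι * c) ^ 2 * (x ⬝ᵥ x) := by
  have hrow : ∀ i, (M *ᵥ x) i * (M *ᵥ x) i ≤ Fintype.card ι * c ^ 2 * (x ⬝ᵥ x) := by
    intro i
    have h1 : (∑ j, M i j * x j) ^ 2 ≤ (∑ j, M i j ^ 2) * ∑ j, x j ^ 2 :=
      Finset.sum_mul_sq_le_sq_mul_sq _ _ _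
    have h2 : ∑ j, M i j ^ 2 ≤ Fintype.card ι * c ^ 2 := by
      calc ∑ j, M i j ^ 2 ≤ ∑ _j : ι, c ^ 2 := Finset.sum_le_sum fun j _ =>
            sq_le_sq' (neg_le_of_abs_le (hM i j)) (le_of_abs_le (hM i j))
        _ = _ := by simp
    have h3 : x ⬝ᵥ x = ∑ j, x j ^ 2 := by simp only [dotProduct, sq]
    rw [h3, ← sq]
    exact h1.trans (mul_le_mul_of_nonneg_right h2 (Finset.sum_nonneg fun j _ => sq_nonneg _))
  calc (M *ᵥ x) ⬝ᵥ (M *ᵥ x) ≤ ∑ _i : ι, Fintype.card ι * c ^ 2 * (x ⬝ᵥ x) :=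
        Finset.sum_le_sum fun i _ => hrow i
    _ = _ := by
        rw [Finset.sum_const, Finset.card_univ, nsmul_eq_mul]
        ring

/-- The conditions are closed. Since `K` contains a box, evaluation at `r (e_i ± e_j)` bounds every
entry by polarization. -/
theorem isCompact_posSemidef_quad_le_one {K : Set (ι → ℝ)} {r : ℝ} (hr : 0 < r)
    (hK : ∀ x : ι → ℝ, (∀ i, |x i| ≤ 2 * r) → x ∈ K) :
    IsCompact {Q : Matrix ι ι ℝ | Q.PosSemidef ∧ ∀ x ∈ K, x ⬝ᵥ Q *ᵥ x ≤ 1} := by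
  classical
  have hcpt : IsCompact {Q : Matrix ι ι ℝ | ∀ i j, Q i j ∈ Set.Icc (-(1 / r ^ 2)) (1 / r ^ 2)} := by
    have : IsCompact (Set.univ.pi fun _ : ι => Set.univ.pi fun _ : ι =>
        Set.Icc (-(1 / r ^ 2)) (1 / r ^ 2)) :=
      isCompact_univ_pi fun _ => isCompact_univ_pi fun _ => isCompact_Icc
    have heq : (Set.univ.pi fun _ : ι => Set.univ.pi fun _ : ι =>
        Set.Icc (-(1 / r ^ 2)) (1 / r ^ 2)) =
        {Q : ι → ι → ℝ | ∀ i j, Q i j ∈ Set.Icc (-(1 / r ^ 2)) (1 / r ^ 2)} := by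
      ext Q
      simp only [Set.mem_ofPred_eq, Set.mem_pi, Set.mem_univ, forall_true_left]
    rw [heq] at this
    exact this
  have hcont : ∀ x : ι → ℝ, Continuous fun Q : Matrix ι ι ℝ => x ⬝ᵥ Q *ᵥ x := fun x => by
    fun_prop
  refine hcpt.of_isClosed_subset ?_ ?_
  · have : {Q : Matrix ι ι ℝ | Q.PosSemidef ∧ ∀ x ∈ K, x ⬝ᵥ Q *ᵥ x ≤ 1} =
        {Q | Qᵀ = Q} ∩ ((⋂ x, {Q | 0 ≤ x ⬝ᵥ Q *ᵥ x}) ∩ ⋂ x ∈ K, {Q | x ⬝ᵥ Q *ᵥ x ≤ 1}) := by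
      ext Q
      simp only [Set.mem_inter_iff, Set.mem_iInter, Set.mem_ofPred_eq]
      exact ⟨fun h => ⟨h.1.isSymm, h.1.quad_nonneg, h.2⟩,
        fun h => ⟨posSemidef_of_isSymm h.1 h.2.1, h.2.2⟩⟩
    rw [this]
    refine (isClosed_eq (by fun_prop) continuous_id).inter ((isClosed_iInter fun x =>
      isClosed_le continuous_const (hcont x)).inter (isClosed_biInter fun x _ =>
        isClosed_le (hcont x) continuous_const))
  · rintro Q ⟨hQ, hle⟩ i j
    -- The case `i = j` is why the box has half-width `2 * r`.
    have hmem : ∀ s : ℝ, |s| ≤ 1 → r • (Pi.single i 1 + s • Pi.single j 1 : ι → ℝ) ∈ K := by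
      intro s hs
      refine hK _ fun k => ?_
      have h1 : |(Pi.single i 1 : ι → ℝ) k| ≤ 1 := by
        rcases eq_or_ne k i with rfl | h <;> simp [*]
      have h2 : |(Pi.single j 1 : ι → ℝ) k| ≤ 1 := by
        rcases eq_or_ne k j with rfl | h <;> simp [*]
      have h3 : |s * (Pi.single j 1 : ι → ℝ) k| ≤ 1 := by
        rw [abs_mul]; exact mul_le_one₀ hs (abs_nonneg _) h2
      simp only [Pi.smul_apply, Pi.add_apply, smul_eq_mul, abs_mul, abs_of_pos hr]
      nlinarith [abs_add_le ((Pi.single i 1 : ι → ℝ) k) (s * (Pi.single j 1 : ι → ℝ) k)]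
    have hexp : ∀ s : ℝ, (Pi.single i 1 + s • Pi.single j 1 : ι → ℝ) ⬝ᵥ
        Q *ᵥ (Pi.single i 1 + s • Pi.single j 1) = Q i i + 2 * s * Q i j + s ^ 2 * Q j j := by
      intro s
      have hsym : Q j i = Q i j := congrFun (congrFun hQ.isSymm i) j
      simp only [mulVec_add, mulVec_smul, add_dotProduct, dotProduct_add, smul_dotProduct,
        dotProduct_smul, smul_eq_mul, mulVec_single_one, single_one_dotProduct, col_apply, hsym]
      ring
    have hb : ∀ s : ℝ, |s| ≤ 1 → Q i i + 2 * s * Q i j + s ^ 2 * Q j j ≤ 1 / r ^ 2 := by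
      intro s hs
      have h := hle _ (hmem s hs)
      rw [dotProduct_mulVec_smul_self, hexp] at h
      rw [le_div_iff₀ (by positivity)]
      linarith
    have hi : 0 ≤ Q i i := hQ.diag_nonneg
    have hj : 0 ≤ Q j j := hQ.diag_nonneg
    have h1 := hb 1 (by norm_num)
    have h2 := hb (-1) (by norm_num)
    have h3 : 0 ≤ 1 / r ^ 2 := by positivity
    constructor <;> linarith

/-- Compare first-order terms at `t = 0`. Multiplying by `(1 - t) ^ N` and using Bernoulli gives `(1
+ t s)(1 - N t) ≤ 1`, which fails for small `t` if `s > N`. -/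
theorem le_natCast_of_forall_one_add_mul_le {s : ℝ} {N : ℕ}
    (h : ∀ t : ℝ, 0 < t → 1 + t * s ≤ (1 + t) ^ N) : s ≤ N := by
  by_contra! hlt
  have hN : (0 : ℝ) ≤ N := Nat.cast_nonneg N
  have hs : 0 < s := hN.trans_lt hlt
  obtain ⟨t, ht, ht1, hts⟩ : ∃ t : ℝ, 0 < t ∧ t ≤ 1 ∧ N * s * t < s - N := by
    refine ⟨min 1 ((s - N) / (N * s + 1)), lt_min one_pos (div_pos (by linarith) (by positivity)),
      min_le_left _ _, ?_⟩
    have hle := min_le_right 1 ((s - N) / (N * s + 1))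
    rw [le_div_iff₀ (by positivity)] at hle
    have hpos : 0 < min 1 ((s - N) / (N * s + 1)) :=
      lt_min one_pos (div_pos (by linarith) (by positivity))
    nlinarith
  have h1 := h t ht
  have h2 : 1 + (N : ℝ) * (-t) ≤ (1 + -t) ^ N := one_add_mul_le_pow (by linarith) N
  have h3 : (1 + t) ^ N * (1 + -t) ^ N ≤ 1 := by
    rw [← mul_pow]
    exact pow_le_one₀ (by nlinarith) (by nlinarith)
  have h4 : (1 + t * s) * (1 + -t) ^ N ≤ 1 :=
    (mul_le_mul_of_nonneg_right h1 (pow_nonneg (by linarith) _)).trans h3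
  have h5 : (1 + t * s) * (1 + N * -t) ≤ 1 :=
    (mul_le_mul_of_nonneg_left h2 (by positivity)).trans h4
  have h6 : t * (s - N - N * s * t) ≤ 0 := by linarith
  nlinarith

theorem det_add_smul_vecMulVec [DecidableEq ι] {Q : Matrix ι ι ℝ} (hQ : IsUnit Q.det) (t : ℝ)
    (w : ι → ℝ) : (Q + t • vecMulVec w w).det = Q.det * (1 + t * (w ⬝ᵥ Q⁻¹ *ᵥ w)) := by
  have h := det_add_replicateCol_mul_replicateRow (ι := Unit) hQ (t • w) w
  rw [← vecMulVec_eq, smul_vecMulVec] at h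
  rw [h]
  congr 1
  rw [det_unique, add_apply, one_apply_eq, ← replicateRow_vecMul,
    replicateRow_mul_replicateCol_apply, dotProduct_smul, dotProduct_mulVec, smul_eq_mul]

/-- John's theorem for the symmetric convex body `K` cut out by a bounded family `F` of linear
functionals: an ellipsoid `x ⬝ᵥ Q *ᵥ x ≤ 1` of least volume containing `K` is contained in
`√(dim) • K`. -/
theorem exists_john_ellipsoid [DecidableEq ι] (F : Set (ι → ℝ)) {C : ℝ}
    (hF : ∀ w ∈ F, ∀ i, |w i| ≤ C) (hsingle : ∀ i, Pi.single i 1 ∈ F) :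
    ∃ Q : Matrix ι ι ℝ, Q.PosDef ∧ (∀ x, (∀ w ∈ F, |w ⬝ᵥ x| ≤ 1) → x ⬝ᵥ Q *ᵥ x ≤ 1) ∧
      ∀ w ∈ F, ∀ x, (w ⬝ᵥ x) ^ 2 ≤ Fintype.card ι * (x ⬝ᵥ Q *ᵥ x) := by
  set K : Set (ι → ℝ) := {x | ∀ w ∈ F, |w ⬝ᵥ x| ≤ 1} with hKdef
  set D : ℝ := (Fintype.card ι : ℝ) with hD
  have hD0 : 0 ≤ D := Nat.cast_nonneg _
  have hball : ∀ x : ι → ℝ, (∀ i, |x i| ≤ 2 * (1 / (2 * (D * |C| + 1)))) → x ∈ K := by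
    intro x hx w hw
    calc |w ⬝ᵥ x| ≤ ∑ i, |w i * x i| := Finset.abs_sum_le_sum_abs _ _
      _ ≤ ∑ _i : ι, |C| * (1 / (D * |C| + 1)) := by
          refine Finset.sum_le_sum fun i _ => ?_
          rw [abs_mul]
          refine mul_le_mul ((hF w hw i).trans (le_abs_self C)) ((hx i).trans_eq ?_)
            (abs_nonneg _) (abs_nonneg _)
          field_simp
      _ = D * |C| / (D * |C| + 1) := by
          rw [Finset.sum_const, nsmul_eq_mul, Finset.card_univ]; ring
      _ ≤ 1 := by rw [div_le_one (by positivity)]; linarith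
  have hcpt := isCompact_posSemidef_quad_le_one (by positivity) hball
  -- The coordinate functionals in `F` confine `K` to the unit cube, where `x ⬝ᵥ x ≤ D`. This
  -- admissible form makes the maximal determinant positive.
  have hεmem : (1 / (D + 1)) • (1 : Matrix ι ι ℝ) ∈
      {Q : Matrix ι ι ℝ | Q.PosSemidef ∧ ∀ x ∈ K, x ⬝ᵥ Q *ᵥ x ≤ 1} := by
    refine ⟨PosSemidef.one.smul (by positivity), fun x hx => ?_⟩
    rw [smul_mulVec, one_mulVec, dotProduct_smul, smul_eq_mul]
    have : x ⬝ᵥ x ≤ D := by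
      calc x ⬝ᵥ x ≤ ∑ _i : ι, (1 : ℝ) := by
            refine Finset.sum_le_sum fun i _ => ?_
            have h := hx _ (hsingle i)
            rw [single_one_dotProduct] at h
            nlinarith [abs_le.1 h]
        _ = D := by simp [hD]
    rw [one_div, inv_mul_le_iff₀ (by positivity)]
    linarith
  -- Maximal determinant means least volume of the ellipsoid.
  obtain ⟨Q, ⟨hQ, hQK⟩, hmax⟩ := hcpt.exists_isMaxOn ⟨_, hεmem⟩
    (Continuous.continuousOn (f := fun Q : Matrix ι ι ℝ => Q.det) (by fun_prop))
  have hdet : 0 < Q.det := by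
    have h := hmax hεmem
    simp only [Set.mem_ofPred_eq, det_smul, det_one, mul_one] at h
    exact (by positivity : (0 : ℝ) < (1 / (D + 1)) ^ Fintype.card ι).trans_le h
  have hPD : Q.PosDef := hQ.posDef_iff_det_ne_zero.2 hdet.ne'
  refine ⟨Q, hPD, hQK, fun w hw x => (hPD.dotProduct_sq_le w x).trans ?_⟩
  refine mul_le_mul_of_nonneg_right ?_ (hQ.quad_nonneg x)
  refine le_natCast_of_forall_one_add_mul_le fun t ht => ?_
  -- Both `Q` and `w wᵀ` are at most `1` on `K`, hence so is this weighted mean. By the matrix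
  -- determinant lemma, maximality of `det Q` reads `1 + t s ≤ (1 + t) ^ D` with `s = w ⬝ᵥ Q⁻¹ *ᵥ
  -- w`, whence `s ≤ D`.
  have hmem : (1 + t)⁻¹ • (Q + t • vecMulVec w w) ∈
      {Q : Matrix ι ι ℝ | Q.PosSemidef ∧ ∀ x ∈ K, x ⬝ᵥ Q *ᵥ x ≤ 1} := by
    refine ⟨(hQ.add (PosSemidef.smul ?_ ht.le)).smul (by positivity), fun x hx => ?_⟩
    · simpa using posSemidef_vecMulVec_self_star w
    · rw [smul_mulVec, add_mulVec, smul_mulVec, dotProduct_smul, dotProduct_add, dotProduct_smul,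
        dotProduct_vecMulVec_mulVec, smul_eq_mul, smul_eq_mul, inv_mul_le_iff₀ (by positivity)]
      have h1 := hQK x hx
      have h2 : (w ⬝ᵥ x) ^ 2 ≤ 1 := (sq_le_one_iff_abs_le_one _).2 (hx w hw)
      nlinarith
  have h := hmax hmem
  simp only [Set.mem_ofPred_eq, det_smul] at h
  rw [det_add_smul_vecMulVec hdet.ne'.isUnit, inv_pow, inv_mul_le_iff₀ (by positivity),
    mul_comm (_ ^ _)] at h
  exact le_of_mul_le_mul_left h hdet

end Matrix

open MvPolynomial

namespace CJSR

variable {V : Type*} {m n : ℕ}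

/-! ### Linear substitutions -/

theorem substLinear_mul (M M' : Matrix (Fin n) (Fin n) ℝ) (p : MvPolynomial (Fin n) ℝ) :
    substLinear (M * M') p = substLinear M' (substLinear M p) := by
  simp only [substLinear, bind₁_bind₁]
  congr 2
  funext i
  simp only [map_sum, map_mul, bind₁_C_right, bind₁_X_right, Matrix.mul_apply, Finset.mul_sum,
    Finset.sum_mul]
  rw [Finset.sum_comm]
  simp only [mul_assoc]

theorem substLinear_one (p : MvPolynomial (Fin n) ℝ) : substLinear 1 p = p := by
  have : (fun i : Fin n => ∑ j, C ((1 : Matrix (Fin n) (Fin n) ℝ) i j) * X j) = X := by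
    funext i
    simp [Matrix.one_apply]
  rw [substLinear, this, bind₁_X_left, AlgHom.id_apply]

theorem eval_substLinear (M : Matrix (Fin n) (Fin n) ℝ) (p : MvPolynomial (Fin n) ℝ)
    (x : Fin n → ℝ) : eval x (substLinear M p) = eval (M *ᵥ x) p := by
  simp only [substLinear, ← coe_aeval_eq_eval, RingHom.coe_coe]
  rw [aeval_bind₁]
  congr 2
  funext i
  simp [Matrix.mulVec, dotProduct, aeval_eq_eval]

theorem isHomogeneous_substLinear (M : Matrix (Fin n) (Fin n) ℝ) {p : MvPolynomial (Fin n) ℝ}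
    {k : ℕ} (hp : p.IsHomogeneous k) : (substLinear M p).IsHomogeneous k := by
  have h := hp.aeval (fun i => ∑ j, C (M i j) * X j) (n := 1) fun i =>
    IsHomogeneous.sum _ _ _ fun j _ => by
      simpa using (isHomogeneous_C (Fin n) (M i j)).mul (isHomogeneous_X ℝ j)
  rwa [one_mul] at h

/-! ### Monomials of degree `d` and the lift of a matrix to them -/

/-- The monomial of degree `d` with the given multiset of variables. -/
noncomputable def symMonomial (d : ℕ) (α : Sym (Fin n) d) : MvPolynomial (Fin n) ℝ :=
  (α.val.map X).prod

theorem prod_map_X_eq_monomial (s : Multiset (Fin n)) :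
    (s.map X).prod = (monomial (Multiset.toFinsupp s) 1 : MvPolynomial (Fin n) ℝ) := by
  induction s using Multiset.induction_on with
  | empty => simp
  | cons i s ih =>
    rw [Multiset.map_cons, Multiset.prod_cons, ih, ← Multiset.singleton_add, map_add,
      Multiset.toFinsupp_singleton, X, monomial_mul, one_mul]

theorem degree_toFinsupp (s : Multiset (Fin n)) :
    (Multiset.toFinsupp s).degree = s.card := by
  rw [Finsupp.degree_eq_sum]
  simp only [Multiset.toFinsupp_apply]
  exact Multiset.sum_count_eq_card fun i _ => Finset.mem_univ i

theorem isHomogeneous_symMonomial (d : ℕ) (α : Sym (Fin n) d) :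
    (symMonomial d α).IsHomogeneous d := by
  rw [symMonomial, prod_map_X_eq_monomial]
  exact isHomogeneous_monomial _ ((degree_toFinsupp _).trans α.2)

theorem coeff_symMonomial (d : ℕ) (α β : Sym (Fin n) d) :
    coeff (Multiset.toFinsupp β.val) (symMonomial d α) = if α = β then 1 else 0 := by
  rw [symMonomial, prod_map_X_eq_monomial, coeff_monomial]
  simp only [EmbeddingLike.apply_eq_iff_eq]
  exact if_congr Sym.coe_inj rfl rfl

theorem eq_sum_symMonomial {d : ℕ} {p : MvPolynomial (Fin n) ℝ} (hp : p.IsHomogeneous d) :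
    p = ∑ β : Sym (Fin n) d, C (coeff (Multiset.toFinsupp β.val) p) * symMonomial d β := by
  ext e
  rw [coeff_sum]
  simp only [coeff_C_mul]
  by_cases he : e.degree = d
  · obtain ⟨s, rfl⟩ := (Multiset.toFinsupp (α := Fin n)).surjective e
    rw [degree_toFinsupp] at he
    obtain ⟨α, rfl⟩ : ∃ α : Sym (Fin n) d, α.val = s := ⟨Sym.mk s he, rfl⟩
    rw [Finset.sum_eq_single α (fun β _ hβ => by rw [coeff_symMonomial, if_neg hβ, mul_zero])
      (fun h => absurd (Finset.mem_univ _) h), coeff_symMonomial, if_pos rfl, mul_one]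
  · rw [hp.coeff_eq_zero he, Finset.sum_eq_zero fun β _ => by
      rw [(isHomogeneous_symMonomial d β).coeff_eq_zero he, mul_zero]]

/-- The matrix of the substitution `x ↦ M x` on the monomials of degree `d`. -/
noncomputable def symLiftAux (d : ℕ) (M : Matrix (Fin n) (Fin n) ℝ) :
    Matrix (Sym (Fin n) d) (Sym (Fin n) d) ℝ :=
  fun α β => coeff (Multiset.toFinsupp β.val) (substLinear M (symMonomial d α))

theorem substLinear_symMonomial (d : ℕ) (M : Matrix (Fin n) (Fin n) ℝ) (α : Sym (Fin n) d) :
    substLinear M (symMonomial d α) =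
      ((symLiftAux d M).map C *ᵥ symMonomial d) α :=
  eq_sum_symMonomial (isHomogeneous_substLinear M (isHomogeneous_symMonomial d α))

/-- The `d`-th symmetric power of matrices, as a monoid homomorphism. -/
noncomputable def symLift (d : ℕ) :
    Matrix (Fin n) (Fin n) ℝ →* Matrix (Sym (Fin n) d) (Sym (Fin n) d) ℝ where
  toFun := symLiftAux d
  map_one' := by
    ext α β
    rw [symLiftAux, substLinear_one, coeff_symMonomial, Matrix.one_apply]
  map_mul' M M' := by
    ext α γ
    rw [symLiftAux, substLinear_mul, substLinear_symMonomial]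
    have : substLinear M' (((symLiftAux d M).map C *ᵥ symMonomial d) α) =
        ∑ β, C (symLiftAux d M α β) * substLinear M' (symMonomial d β) := by
      simp [substLinear, Matrix.mulVec, dotProduct]
    rw [this, coeff_sum, Matrix.mul_apply]
    simp only [coeff_C_mul]
    rfl

/-- Each variable becomes a linear form with `n` terms. Multiplication by `X j` only shifts
coefficients, so each factor costs at most `n * c`. -/
theorem abs_coeff_substLinear_prod_le {M : Matrix (Fin n) (Fin n) ℝ} {c : ℝ} (hc : 0 ≤ c)
    (hM : ∀ i j, |M i j| ≤ c) (s : Multiset (Fin n)) :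
    ∀ e, |coeff e (substLinear M (s.map X).prod)| ≤ (n * c) ^ s.card := by
  induction s using Multiset.induction_on with
  | empty =>
    intro e
    simp only [substLinear, Multiset.map_zero, Multiset.prod_zero, map_one, coeff_one,
      Multiset.card_zero, pow_zero]
    split_ifs <;> simp
  | cons i s ih =>
    intro e
    have : substLinear M ((i ::ₘ s).map X).prod =
        ∑ j, C (M i j) * (X j * substLinear M (s.map X).prod) := by
      simp only [substLinear, Multiset.map_cons, Multiset.prod_cons, map_mul, bind₁_X_right,
        Finset.sum_mul, mul_assoc]
    rw [this, coeff_sum]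
    calc |∑ j, coeff e (C (M i j) * (X j * substLinear M (s.map X).prod))|
        ≤ ∑ j, |coeff e (C (M i j) * (X j * substLinear M (s.map X).prod))| :=
          Finset.abs_sum_le_sum_abs _ _
      _ ≤ ∑ _j : Fin n, c * (n * c) ^ s.card := by
          refine Finset.sum_le_sum fun j _ => ?_
          rw [coeff_C_mul, abs_mul, coeff_X_mul']
          refine mul_le_mul (hM i j) ?_ (abs_nonneg _) hc
          split_ifs
          · exact ih _
          · simpa using pow_nonneg (mul_nonneg n.cast_nonneg hc) _
      _ = (n * c) ^ (i ::ₘ s).card := by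
          rw [Finset.sum_const, Finset.card_univ, Fintype.card_fin, nsmul_eq_mul,
            Multiset.card_cons, pow_succ]
          ring

theorem abs_symLift_le (d : ℕ) {M : Matrix (Fin n) (Fin n) ℝ} {c : ℝ} (hc : 0 ≤ c)
    (hM : ∀ i j, |M i j| ≤ c) (α β : Sym (Fin n) d) : |symLift d M α β| ≤ (n * c) ^ d := by
  have h := abs_coeff_substLinear_prod_le hc hM α.val (Multiset.toFinsupp β.val)
  rwa [α.2] at h

/-! ### Gram matrices -/

/-- The form of degree `2 d` with the Gram matrix `Q`. -/
noncomputable def gramPoly (d : ℕ) (Q : Matrix (Sym (Fin n) d) (Sym (Fin n) d) ℝ) :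
    MvPolynomial (Fin n) ℝ :=
  symMonomial d ⬝ᵥ Q.map C *ᵥ symMonomial d

theorem gramPoly_sub (d : ℕ) (Q Q' : Matrix (Sym (Fin n) d) (Sym (Fin n) d) ℝ) :
    gramPoly d (Q - Q') = gramPoly d Q - gramPoly d Q' := by
  rw [gramPoly, Matrix.map_sub _ (map_sub C), Matrix.sub_mulVec, dotProduct_sub]
  rfl

theorem gramPoly_smul (d : ℕ) (c : ℝ) (Q : Matrix (Sym (Fin n) d) (Sym (Fin n) d) ℝ) :
    gramPoly d (c • Q) = C c * gramPoly d Q := by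
  have : (c • Q).map C = (C c : MvPolynomial (Fin n) ℝ) •
      Q.map (C : ℝ →+* MvPolynomial (Fin n) ℝ) := by
    ext1 α β
    simp
  rw [gramPoly, this, Matrix.smul_mulVec, dotProduct_smul, smul_eq_mul]
  rfl

/-- Substitution is linear on the vector of monomials, hence a congruence on Gram matrices. -/
theorem substLinear_gramPoly (d : ℕ) (M : Matrix (Fin n) (Fin n) ℝ)
    (Q : Matrix (Sym (Fin n) d) (Sym (Fin n) d) ℝ) :
    substLinear M (gramPoly d Q) = gramPoly d ((symLift d M)ᵀ * Q * symLift d M) := by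
  have h : ∀ α, bind₁ (fun i => ∑ j, C (M i j) * X j) (symMonomial d α) =
      ((symLift d M).map C *ᵥ symMonomial d) α := substLinear_symMonomial d M
  have h' : substLinear M (gramPoly d Q) =
      ((symLift d M).map C *ᵥ symMonomial d) ⬝ᵥ
        Q.map C *ᵥ ((symLift d M).map C *ᵥ symMonomial d) := by
    simp only [substLinear, gramPoly, dotProduct, Matrix.mulVec, map_sum, map_mul,
      Matrix.map_apply, bind₁_C_right] at h ⊢
    simp only [h]
  rw [h', gramPoly, Matrix.map_mul, Matrix.map_mul, Matrix.transpose_map,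
    ← Matrix.mulVec_mulVec, ← Matrix.mulVec_mulVec, Matrix.dotProduct_mulVec _ (_ᵀ),
    Matrix.vecMul_transpose]

theorem eval_gramPoly (d : ℕ) (Q : Matrix (Sym (Fin n) d) (Sym (Fin n) d) ℝ) (x : Fin n → ℝ) :
    eval x (gramPoly d Q) =
      (fun α => eval x (symMonomial d α)) ⬝ᵥ Q *ᵥ fun α => eval x (symMonomial d α) := by
  simp [gramPoly, dotProduct, Matrix.mulVec]

theorem isHomogeneous_gramPoly (d : ℕ) (Q : Matrix (Sym (Fin n) d) (Sym (Fin n) d) ℝ) :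
    (gramPoly d Q).IsHomogeneous (2 * d) := by
  rw [two_mul]
  refine IsHomogeneous.sum _ _ _ fun α _ => (isHomogeneous_symMonomial d α).mul ?_
  refine IsHomogeneous.sum _ _ _ fun β _ => ?_
  simpa using (isHomogeneous_C (Fin n) (Q α β)).mul (isHomogeneous_symMonomial d β)

open scoped MatrixOrder in
-- Factor `Q = Bᵀ B`: the squares are those of the entries of `B x^[d]`.
theorem isSumSq_gramPoly (d : ℕ) {Q : Matrix (Sym (Fin n) d) (Sym (Fin n) d) ℝ}
    (hQ : Q.PosSemidef) : IsSumSq (gramPoly d Q) := by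
  obtain ⟨B, rfl⟩ := CStarAlgebra.nonneg_iff_eq_star_mul_self.mp hQ.nonneg
  rw [Matrix.star_eq_conjTranspose, Matrix.conjTranspose_eq_transpose_of_trivial, gramPoly,
    Matrix.map_mul, Matrix.transpose_map, ← Matrix.mulVec_mulVec, Matrix.dotProduct_mulVec,
    Matrix.vecMul_transpose]
  exact IsSumSq.sum fun α _ => IsSumSq.mul_self _

theorem eval_gramPoly_pos (d : ℕ) {Q : Matrix (Sym (Fin n) d) (Sym (Fin n) d) ℝ}
    (hQ : Q.PosDef) {x : Fin n → ℝ} (hx : x ≠ 0) : 0 < eval x (gramPoly d Q) := by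
  rw [eval_gramPoly]
  refine hQ.quad_pos fun h => ?_
  obtain ⟨i, hi⟩ := Function.ne_iff.1 hx
  -- The monomial `X i ^ d` does not vanish at `x` when `x i ≠ 0`.
  have := congrFun h (Sym.replicate d i)
  change eval x ((Multiset.replicate d i).map X).prod = 0 at this
  rw [Multiset.map_replicate, Multiset.prod_replicate, map_pow, eval_X] at this
  exact pow_ne_zero d hi this

/-! ### The sphere integral -/

theorem sphereIntegral_C_mul (c : ℝ) (p : MvPolynomial (Fin n) ℝ) :
    sphereIntegral (C c * p) = c * sphereIntegral p := by
  simp only [sphereIntegral, map_mul, eval_C]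
  exact MeasureTheory.integral_const_mul _ _

theorem sphereIntegral_pos (hn : 1 ≤ n) {p : MvPolynomial (Fin n) ℝ}
    (hp : ∀ x : Fin n → ℝ, x ≠ 0 → 0 < eval x p) : 0 < sphereIntegral p := by
  have hpos : ∀ x : Metric.sphere (0 : EuclideanSpace ℝ (Fin n)) 1,
      0 < eval (fun i => x.val i) p := by
    intro x
    refine hp _ fun h => ?_
    have hx := norm_eq_of_mem_sphere x
    have : x.val = 0 := by
      ext i
      exact congrFun h i
    rw [this, norm_zero] at hx
    exact zero_ne_one hx
  have hcont : Continuous fun x : Metric.sphere (0 : EuclideanSpace ℝ (Fin n)) 1 =>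
      eval (fun i => x.val i) p := by
    refine (MvPolynomial.continuous_eval p).comp ?_
    fun_prop
  have hint := hcont.integrable_of_hasCompactSupport
    (μ := (MeasureTheory.volume : MeasureTheory.Measure (EuclideanSpace ℝ (Fin n))).toSphere)
    (HasCompactSupport.of_compactSpace _)
  rw [sphereIntegral, MeasureTheory.integral_pos_iff_support_of_nonneg (fun x => (hpos x).le) hint,
    Set.eq_univ_of_forall (s := Function.support _) fun x => (hpos x).ne']
  have : Nonempty (Fin n) := ⟨⟨0, hn⟩⟩
  rw [MeasureTheory.Measure.measure_univ_pos]
  exact MeasureTheory.Measure.toSphere_ne_zero _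

/-! ### Reduction of the sum of squares program to matrix inequalities -/

/-- All conditions but the normalization are invariant under a common positive scaling of the `Q v`,
so division by the total sphere integral is allowed. -/
theorem mem_sosValues_of_posSemidef [Fintype V] [Nonempty V] (hn : 1 ≤ n)
    {G : LabelledGraph V (Fin m)} {A : Fin m → Matrix (Fin n) (Fin n) ℝ} {d : ℕ} {γ : ℝ}
    (hγ : 0 ≤ γ) {Q : V → Matrix (Sym (Fin n) d) (Sym (Fin n) d) ℝ} (hQ : ∀ v, (Q v).PosDef)
    (h : ∀ u v σ, (u, v, σ) ∈ G.edges →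
      (γ ^ (2 * d) • Q u - (symLift d (A σ))ᵀ * Q v * symLift d (A σ)).PosSemidef) :
    γ ∈ sosValues G A d := by
  set S := ∑ v, sphereIntegral (gramPoly d (Q v)) with hS
  have hS0 : 0 < S := Finset.sum_pos
    (fun v _ => sphereIntegral_pos hn fun _ => eval_gramPoly_pos d (hQ v)) Finset.univ_nonempty
  have hQ' : ∀ v, (S⁻¹ • Q v).PosDef := fun v => (hQ v).smul (inv_pos.2 hS0)
  refine ⟨fun v => gramPoly d (S⁻¹ • Q v), hγ, fun v => isHomogeneous_gramPoly d _, ?_,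
    fun v => isSumSq_gramPoly d (hQ' v).posSemidef, fun v _ => eval_gramPoly_pos d (hQ' v), ?_⟩
  · intro u v σ he
    rw [substLinear_gramPoly, ← gramPoly_smul, ← gramPoly_sub]
    refine isSumSq_gramPoly d ?_
    convert (h u v σ he).smul (inv_pos.2 hS0).le using 1
    rw [smul_sub, Matrix.mul_smul, Matrix.smul_mul, smul_comm]
  · simp only [gramPoly_smul, sphereIntegral_C_mul]
    rw [← Finset.mul_sum, inv_mul_cancel₀ hS0.ne']

end CJSR

/-! ### Contracting quadratic forms from growth along paths -/

namespace LabelledGraph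

variable {V L ι : Type*} [Fintype ι] [DecidableEq ι]

/-- The matrix product along a path, the last edge acting last. -/
def pathProd (B : L → Matrix ι ι ℝ) (s : List (V × V × L)) : Matrix ι ι ℝ :=
  (s.map fun e => B e.2.2).reverse.prod

theorem pathProd_nil (B : L → Matrix ι ι ℝ) : pathProd (V := V) B [] = 1 := by simp [pathProd]

theorem pathProd_cons (B : L → Matrix ι ι ℝ) (e : V × V × L) (s : List (V × V × L)) :
    pathProd B (e :: s) = pathProd B s * B e.2.2 := by simp [pathProd]

/-- If the products along the paths grow at most like `g ^ k`, John's theorem applied to the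
associated extremal norms gives quadratic forms that contract at the rate `√(dim) g`. -/
theorem exists_posDef_of_abs_pathProd_le (G : LabelledGraph V L) (B : L → Matrix ι ι ℝ) {g C : ℝ}
    (hg : 0 < g)
    (hB : ∀ k, ∀ s ∈ G.paths k, ∀ i j, |pathProd B s i j| ≤ C * g ^ k) :
    ∃ Q : V → Matrix ι ι ℝ, (∀ v, (Q v).PosDef) ∧ ∀ u v σ, (u, v, σ) ∈ G.edges →
      ((Fintype.card ι * g ^ 2) • Q u - (B σ)ᵀ * Q v * B σ).PosSemidef := by
  -- The supremum of `|w ⬝ᵥ x|` over `w ∈ F u` is the extremal norm at `u`; the empty walk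
  -- contributes the coordinates.
  set F : V → Set (ι → ℝ) := fun u =>
    {w | ∃ s ∈ G.walks u, ∃ i, w = (g ^ s.length)⁻¹ • pathProd B s i} with hF
  have hFb : ∀ u, ∀ w ∈ F u, ∀ i, |w i| ≤ C := by
    rintro u _ ⟨s, hs, i, rfl⟩ j
    have h := hB _ s (G.mem_paths_of_mem_walks hs) i j
    rw [Pi.smul_apply, smul_eq_mul, abs_mul, abs_of_pos (by positivity),
      inv_mul_le_iff₀ (by positivity), mul_comm]
    exact h
  have hF1 : ∀ u i, Pi.single i 1 ∈ F u := fun u i =>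
    ⟨[], G.nil_mem_walks u, i, by
      ext j
      simp [pathProd_nil, Matrix.one_apply, Pi.single_apply, eq_comm]⟩
  choose Q hQ hle hge using fun u => Matrix.exists_john_ellipsoid (F u) (hFb u) (hF1 u)
  refine ⟨Q, hQ, fun u v σ he => Matrix.posSemidef_smul_sub_of_forall_le (hQ u).posSemidef.isSymm
    (hQ v).posSemidef.isSymm fun x => ?_⟩
  rcases eq_or_ne x 0 with rfl | hx
  · simp
  obtain ⟨i₀, -⟩ := Function.ne_iff.1 hx
  have : Nonempty ι := ⟨i₀⟩
  have hN : (0 : ℝ) < Fintype.card ι := by exact_mod_cast Fintype.card_pos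
  set q := x ⬝ᵥ Q u *ᵥ x with hq
  have hq0 : 0 < q := (hQ u).quad_pos hx
  -- Scaled so that `hge` puts `r • x` in the unit ball at `u`. Prefixing walks from `v` by the edge
  -- then puts `(g⁻¹ * r) • (B σ *ᵥ x)` in the unit ball at `v`, where `hle` applies.
  obtain ⟨r, hr, hr1⟩ : ∃ r : ℝ, 0 < r ∧ r ^ 2 * (Fintype.card ι * q) = 1 := by
    refine ⟨(√(Fintype.card ι * q))⁻¹, by positivity, ?_⟩
    rw [inv_pow, Real.sq_sqrt (by positivity), inv_mul_cancel₀ (by positivity)]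
  have hK : ∀ w ∈ F v, |w ⬝ᵥ ((g⁻¹ * r) • (B σ *ᵥ x))| ≤ 1 := by
    rintro _ ⟨s, hs, i, rfl⟩
    have hmem : (g ^ ((u, v, σ) :: s).length)⁻¹ • pathProd B ((u, v, σ) :: s) i ∈ F u :=
      ⟨_, G.cons_mem_walks.2 ⟨he, rfl, hs⟩, i, rfl⟩
    have h := hge u _ hmem (r • x)
    rw [Matrix.dotProduct_mulVec_smul_self, ← hq, mul_left_comm, hr1] at h
    have heq : ((g ^ s.length)⁻¹ • pathProd B s i) ⬝ᵥ ((g⁻¹ * r) • (B σ *ᵥ x)) =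
        ((g ^ ((u, v, σ) :: s).length)⁻¹ • pathProd B ((u, v, σ) :: s) i) ⬝ᵥ (r • x) := by
      have hrow : pathProd B s i ⬝ᵥ (B σ *ᵥ x) = pathProd B ((u, v, σ) :: s) i ⬝ᵥ x := by
        rw [pathProd_cons]
        exact congrFun (Matrix.mulVec_mulVec x (pathProd B s) (B σ)) i
      simp only [smul_dotProduct, dotProduct_smul, smul_eq_mul, hrow, List.length_cons, pow_succ]
      field_simp
    rw [heq]
    exact (sq_le_one_iff_abs_le_one _).1 h
  have h := hle v _ hK
  rw [Matrix.dotProduct_mulVec_smul_self] at h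
  have hgr : (g⁻¹ * r) ^ 2 * (Fintype.card ι * g ^ 2 * q) = 1 := by
    rw [← hr1]
    field_simp
  exact le_of_mul_le_mul_left (h.trans hgr.ge) (by positivity)

/-- If the squares of the products along the paths of some length `K` add up to at most `g ^ (2 K)`,
a truncated sum over paths gives quadratic forms that contract at the rate `g`. -/
theorem exists_posDef_of_sum_paths_le [Finite V] [Finite L] (G : LabelledGraph V L)
    (B : L → Matrix ι ι ℝ) {g : ℝ} (hg : 0 < g) {K : ℕ} (hK0 : 0 < K)
    (hK : ∀ x : ι → ℝ, ∑ s ∈ (G.paths_finite K).toFinset,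
      (pathProd B s *ᵥ x) ⬝ᵥ (pathProd B s *ᵥ x) ≤ (g ^ 2) ^ K * (x ⬝ᵥ x)) :
    ∃ Q : V → Matrix ι ι ℝ, (∀ v, (Q v).PosDef) ∧ ∀ u v σ, (u, v, σ) ∈ G.edges →
      (g ^ 2 • Q u - (B σ)ᵀ * Q v * B σ).PosSemidef := by
  classical
  set W : V → ℕ → Finset (List (V × V × L)) := fun u j =>
    (G.paths_finite j).toFinset.filter (· ∈ G.walks u) with hW
  have memW : ∀ {u j s}, s ∈ W u j ↔ s.length = j ∧ s ∈ G.walks u := by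
    intro u j s
    simp only [hW, Finset.mem_filter, Set.Finite.mem_toFinset]
    exact ⟨fun h => ⟨h.1.1, h.2⟩, fun h => ⟨h.1 ▸ G.mem_paths_of_mem_walks h.2, h.2⟩⟩
  set S : V → ℕ → (ι → ℝ) → ℝ := fun u j x =>
    ∑ s ∈ W u j, (pathProd B s *ᵥ x) ⬝ᵥ (pathProd B s *ᵥ x) with hS
  have hsq : ∀ y : ι → ℝ, 0 ≤ y ⬝ᵥ y := fun y => Finset.sum_nonneg fun i _ => mul_self_nonneg _
  have hS0 : ∀ u j x, 0 ≤ S u j x := fun u j x => Finset.sum_nonneg fun s _ => hsq _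
  have hSz : ∀ u x, S u 0 x = x ⬝ᵥ x := by
    intro u x
    have : W u 0 = {[]} := by
      ext s
      rw [memW, Finset.mem_singleton, List.length_eq_zero_iff]
      exact ⟨fun h => h.1, fun h => ⟨h, h ▸ G.nil_mem_walks u⟩⟩
    simp only [hS, this, Finset.sum_singleton, pathProd_nil, Matrix.one_mulVec]
  have hSK : ∀ u x, S u K x ≤ (g ^ 2) ^ K * (x ⬝ᵥ x) := fun u x =>
    (Finset.sum_le_sum_of_subset_of_nonneg (Finset.filter_subset _ _)
      fun s _ _ => hsq _).trans (hK x)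
  have hstep : ∀ u v σ, (u, v, σ) ∈ G.edges → ∀ j x, S v j (B σ *ᵥ x) ≤ S u (j + 1) x := by
    intro u v σ he j x
    calc S v j (B σ *ᵥ x) = ∑ s ∈ (W v j).map ⟨List.cons (u, v, σ), List.cons_injective⟩,
          (pathProd B s *ᵥ x) ⬝ᵥ (pathProd B s *ᵥ x) := by
          rw [Finset.sum_map]
          simp only [hS, Function.Embedding.coeFn_mk, pathProd_cons, Matrix.mulVec_mulVec]
      _ ≤ S u (j + 1) x := by
          refine Finset.sum_le_sum_of_subset_of_nonneg ?_ fun s _ _ => hsq _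
          intro s hs
          obtain ⟨t, ht, rfl⟩ := Finset.mem_map.1 hs
          obtain ⟨htl, htw⟩ := memW.1 ht
          exact memW.2 ⟨by simp [htl], G.cons_mem_walks.2 ⟨he, rfl, htw⟩⟩
  set Q : V → Matrix ι ι ℝ := fun u =>
    ∑ j ∈ Finset.range K, ((g ^ 2) ^ j)⁻¹ • ∑ s ∈ W u j, (pathProd B s)ᵀ * pathProd B s with hQ
  have hQq : ∀ u x, x ⬝ᵥ Q u *ᵥ x = ∑ j ∈ Finset.range K, ((g ^ 2) ^ j)⁻¹ * S u j x := by
    intro u x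
    simp only [hQ, hS, Matrix.sum_mulVec, dotProduct_sum, Matrix.smul_mulVec, dotProduct_smul,
      smul_eq_mul, ← Matrix.mulVec_mulVec]
    simp only [Matrix.dotProduct_mulVec x (_ᵀ), Matrix.vecMul_transpose]
  have hQs : ∀ u, (Q u).IsSymm := by
    intro u
    simp only [hQ, Matrix.IsSymm, Matrix.transpose_sum, Matrix.transpose_smul,
      Matrix.transpose_mul, Matrix.transpose_transpose]
  refine ⟨Q, fun u => Matrix.posDef_of_isSymm (hQs u) fun x hx => ?_, fun u v σ he =>
    Matrix.posSemidef_smul_sub_of_forall_le (hQs u) (hQs v) fun x => ?_⟩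
  · rw [hQq]
    have h0 : 0 < x ⬝ᵥ x :=
      lt_of_le_of_ne (hsq x) fun h => hx (dotProduct_self_eq_zero.1 h.symm)
    refine lt_of_lt_of_le ?_ (Finset.single_le_sum
      (fun j _ => mul_nonneg (by positivity) (hS0 u j x)) (Finset.mem_range.2 hK0))
    simpa [hSz] using h0
  · rw [hQq, hQq]
    -- Shifting the index gains the term `j = K` and loses the term `j = 0`, which is `x ⬝ᵥ x`; the
    -- hypothesis on `K` says that the gain is at most the loss.
    have hsum : ∑ j ∈ Finset.range K, ((g ^ 2) ^ (j + 1))⁻¹ * S u (j + 1) x =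
        ∑ j ∈ Finset.range K, ((g ^ 2) ^ j)⁻¹ * S u j x + ((g ^ 2) ^ K)⁻¹ * S u K x - x ⬝ᵥ x := by
      have h1 := Finset.sum_range_succ (fun j => ((g ^ 2) ^ j)⁻¹ * S u j x) K
      have h2 := Finset.sum_range_succ' (fun j => ((g ^ 2) ^ j)⁻¹ * S u j x) K
      simp only [hSz, pow_zero, inv_one, one_mul] at h2
      linarith
    have hlast : ((g ^ 2) ^ K)⁻¹ * S u K x ≤ x ⬝ᵥ x := by
      rw [inv_mul_le_iff₀ (by positivity)]
      exact hSK u x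
    calc ∑ j ∈ Finset.range K, ((g ^ 2) ^ j)⁻¹ * S v j (B σ *ᵥ x)
        ≤ ∑ j ∈ Finset.range K, ((g ^ 2) ^ j)⁻¹ * S u (j + 1) x :=
          Finset.sum_le_sum fun j _ =>
            mul_le_mul_of_nonneg_left (hstep u v σ he j x) (by positivity)
      _ = g ^ 2 * ∑ j ∈ Finset.range K, ((g ^ 2) ^ (j + 1))⁻¹ * S u (j + 1) x := by
          rw [Finset.mul_sum]
          refine Finset.sum_congr rfl fun j _ => ?_
          rw [pow_succ (g ^ 2)]
          field_simp
      _ ≤ g ^ 2 * ∑ j ∈ Finset.range K, ((g ^ 2) ^ j)⁻¹ * S u j x :=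
          mul_le_mul_of_nonneg_left (by rw [hsum]; linarith) (by positivity)

/-- If there are about `b ^ k` paths and the products along them grow at most like `g₀ ^ k`, then
there are quadratic forms that contract at any rate above `√b g₀`. -/
theorem exists_posDef_of_ncard_paths_le [Finite V] [Finite L] (G : LabelledGraph V L)
    (B : L → Matrix ι ι ℝ) {g g₀ b C : ℝ} (hb : 0 < b) (hg₀ : 0 < g₀) (hg : 0 < g)
    (hlt : b * g₀ ^ 2 < g ^ 2)
    (hB : ∀ k, ∀ s ∈ G.paths k, ∀ i j, |pathProd B s i j| ≤ C * g₀ ^ k)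
    (hcard : ∀ᶠ k : ℕ in atTop, ((G.paths k).ncard : ℝ) ≤ b ^ k) :
    ∃ Q : V → Matrix ι ι ℝ, (∀ v, (Q v).PosDef) ∧ ∀ u v σ, (u, v, σ) ∈ G.edges →
      (g ^ 2 • Q u - (B σ)ᵀ * Q v * B σ).PosSemidef := by
  set D := (Fintype.card ι * C) ^ 2 with hD
  -- The number of paths times the bound on their squared products, relative to `g ^ (2 k)`. It
  -- tends to `0`, so some `K` brings it below `1`.
  have hlim : Tendsto (fun k : ℕ => D * (b * g₀ ^ 2 / g ^ 2) ^ k) atTop (𝓝 (D * 0)) :=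
    (tendsto_pow_atTop_nhds_zero_of_lt_one (by positivity)
      ((div_lt_one (by positivity)).2 hlt)).const_mul D
  rw [mul_zero] at hlim
  obtain ⟨K, hK1, hKc, hK0⟩ := ((hlim.eventually (eventually_lt_nhds zero_lt_one)).and
    (hcard.and (eventually_gt_atTop 0))).exists
  refine G.exists_posDef_of_sum_paths_le B hg hK0 fun x => ?_
  have hxx : 0 ≤ x ⬝ᵥ x := Finset.sum_nonneg fun i _ => mul_self_nonneg _
  have hcardF : ((G.paths_finite K).toFinset.card : ℝ) = (G.paths K).ncard := by
    rw [Set.ncard_eq_toFinset_card _ (G.paths_finite K)]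
  calc ∑ s ∈ (G.paths_finite K).toFinset, (pathProd B s *ᵥ x) ⬝ᵥ (pathProd B s *ᵥ x)
      ≤ ∑ s ∈ (G.paths_finite K).toFinset, (Fintype.card ι * (C * g₀ ^ K)) ^ 2 * (x ⬝ᵥ x) :=
        Finset.sum_le_sum fun s hs => Matrix.mulVec_dotProduct_self_le
          (hB K s ((Set.Finite.mem_toFinset _).1 hs)) x
    _ = (G.paths K).ncard * (D * (g₀ ^ 2) ^ K * (x ⬝ᵥ x)) := by
        rw [Finset.sum_const, nsmul_eq_mul, hcardF, hD]
        ring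
    _ ≤ b ^ K * (D * (g₀ ^ 2) ^ K * (x ⬝ᵥ x)) :=
        mul_le_mul_of_nonneg_right hKc (by positivity)
    _ = D * (b * g₀ ^ 2 / g ^ 2) ^ K * ((g ^ 2) ^ K * (x ⬝ᵥ x)) := by
        rw [div_pow, mul_pow]
        field_simp
    _ ≤ 1 * ((g ^ 2) ^ K * (x ⬝ᵥ x)) :=
        mul_le_mul_of_nonneg_right hK1.le (by positivity)
    _ = _ := one_mul _

end LabelledGraph

/-! ### Feasible values above the constrained joint spectral radius -/

namespace CJSR

variable {V : Type*} {m n : ℕ}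

theorem wordProd_map_label (A : Fin m → Matrix (Fin n) (Fin n) ℝ)
    (s : List (V × V × Fin m)) :
    wordProd A (s.map fun e => e.2.2) = LabelledGraph.pathProd A s := by
  simp only [wordProd, LabelledGraph.pathProd, List.map_map]
  rfl

theorem pathProd_symLift (A : Fin m → Matrix (Fin n) (Fin n) ℝ) (d : ℕ)
    (s : List (V × V × Fin m)) :
    LabelledGraph.pathProd (fun σ => symLift d (A σ)) s =
      symLift d (LabelledGraph.pathProd A s) := by
  rw [LabelledGraph.pathProd, LabelledGraph.pathProd, map_list_prod, List.map_reverse,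
    List.map_map]
  rfl

variable (N : Seminorm ℝ (Matrix (Fin n) (Fin n) ℝ)) (G : LabelledGraph V (Fin m))
  (A : Fin m → Matrix (Fin n) (Fin n) ℝ)

/-- Lifting commutes with products and its entries are of degree `d` in those of the matrix, so the
growth rate is raised to the power `d`. -/
theorem exists_abs_pathProd_symLift_le [Finite V] (hN : ∀ M, N M = 0 → M = 0) (d : ℕ) {g : ℝ}
    (hg : cjsr N G A < g) :
    ∃ C, ∀ k, ∀ s ∈ G.paths k, ∀ α β,
      |LabelledGraph.pathProd (fun σ => symLift d (A σ)) s α β| ≤ C * (g ^ d) ^ k := by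
  have hg0 : 0 < g := (cjsr_nonneg N G A hN).trans_lt hg
  obtain ⟨C, hC, hle⟩ := exists_abs_entry_wordProd_le N G A hN hg
  refine ⟨(n * C) ^ d, fun k s hs α β => ?_⟩
  rw [pathProd_symLift, ← wordProd_map_label]
  refine (abs_symLift_le d (by positivity) (hle k _ ⟨s, hs, rfl⟩) α β).trans_eq ?_
  rw [← mul_assoc, mul_pow, ← pow_mul, ← pow_mul, mul_comm k d]

theorem mul_rpow_inv_pow {c g : ℝ} (hc : 0 ≤ c) {d : ℕ} (hd : 1 ≤ d) :
    (c ^ (1 / (2 * (d : ℝ))) * g) ^ (2 * d) = c * (g ^ d) ^ 2 := by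
  have h : (2 * (d : ℝ)) = ((2 * d : ℕ) : ℝ) := by push_cast; ring
  rw [mul_pow, h, one_div, Real.rpow_inv_natCast_pow hc (by omega), ← pow_mul, mul_comm d 2]

/-- Feasibility of the program from John's theorem. -/
theorem choose_rpow_mul_mem_sosValues [Fintype V] [Nonempty V] (hn : 1 ≤ n)
    (hN : ∀ M, N M = 0 → M = 0) {d : ℕ} (hd : 1 ≤ d) {g : ℝ} (hg : cjsr N G A < g) :
    ((n + d - 1).choose d : ℝ) ^ (1 / (2 * (d : ℝ))) * g ∈ sosValues G A d := by
  have hg0 : 0 < g := (cjsr_nonneg N G A hN).trans_lt hg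
  obtain ⟨C, hC⟩ := exists_abs_pathProd_symLift_le N G A hN d hg
  obtain ⟨Q, hQ, hle⟩ := G.exists_posDef_of_abs_pathProd_le _ (pow_pos hg0 d) hC
  refine mem_sosValues_of_posSemidef hn (by positivity) hQ fun u v σ he => ?_
  rw [mul_rpow_inv_pow (Nat.cast_nonneg _) hd]
  have h := hle u v σ he
  rwa [Sym.card_sym_eq_choose, Fintype.card_fin] at h

/-- Feasibility of the program from sums over paths. -/
theorem two_rpow_mul_mem_sosValues [Fintype V] [Nonempty V] (hn : 1 ≤ n)
    (hG : G.StronglyConnected) (hE : G.edges.Nonempty)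
    (hN : ∀ M, N M = 0 → M = 0) {d : ℕ} (hd : 1 ≤ d) {g h : ℝ} (hg : cjsr N G A < g)
    (hh : G.edgeShift.entropy < h) :
    ((2 : ℝ) ^ h) ^ (1 / (2 * (d : ℝ))) * g ∈ sosValues G A d := by
  -- The gap between `g₀` and `g` provides the strict inequality that beats the constants.
  obtain ⟨g₀, hg₀, hlt⟩ := exists_between hg
  have hg0 : 0 < g₀ := (cjsr_nonneg N G A hN).trans_lt hg₀
  have hgpos : 0 < g := hg0.trans hlt
  obtain ⟨C, hC⟩ := exists_abs_pathProd_symLift_le N G A hN d hg₀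
  have h2 : (0 : ℝ) < 2 ^ h := by positivity
  set γ := ((2 : ℝ) ^ h) ^ (1 / (2 * (d : ℝ))) * g with hγ
  have hγ0 : 0 < γ := by positivity
  have hγd : (γ ^ d) ^ 2 = 2 ^ h * (g ^ d) ^ 2 := by
    rw [← mul_rpow_inv_pow h2.le hd, ← pow_mul, mul_comm d 2]
  obtain ⟨Q, hQ, hle⟩ := G.exists_posDef_of_ncard_paths_le _ h2 (pow_pos hg0 d) (pow_pos hγ0 d)
    (by
      rw [hγd]
      refine mul_lt_mul_of_pos_left ?_ h2
      exact pow_lt_pow_left₀ (pow_lt_pow_left₀ hlt hg0.le (by omega)) (by positivity) (by norm_num))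
    hC (LabelledGraph.eventually_ncard_paths_le hG hE hh)
  refine mem_sosValues_of_posSemidef hn hγ0.le hQ fun u v σ he => ?_
  rw [mul_comm 2 d, pow_mul]
  exact hle u v σ he

/-! ### The upper bound -/

theorem eval_nonneg_of_isSumSq {p : MvPolynomial (Fin n) ℝ} (hp : IsSumSq p) (x : Fin n → ℝ) :
    0 ≤ eval x p := by
  induction hp with
  | zero => simp
  | sq_add a _ ih =>
    rw [map_add, map_mul]
    exact add_nonneg (mul_self_nonneg _) ih

theorem eval_smul_of_isHomogeneous {p : MvPolynomial (Fin n) ℝ} {k : ℕ} (hp : p.IsHomogeneous k)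
    (t : ℝ) (x : Fin n → ℝ) : eval (t • x) p = t ^ k * eval x p := by
  rw [eval_eq', eval_eq', Finset.mul_sum]
  refine Finset.sum_congr rfl fun e he => ?_
  have hdeg : ∑ i, e i = k := by
    rw [← Finsupp.degree_eq_sum]
    by_contra h
    exact mem_support_iff.1 he (hp.coeff_eq_zero h)
  simp only [Pi.smul_apply, smul_eq_mul, mul_pow, Finset.prod_mul_distrib, Finset.prod_pow_eq_pow_sum,
    hdeg]
  ring

/-- The minimum over the compact unit sphere is positive, and homogeneity carries it to all `x`. The
sphere is empty when `n = 0`. -/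
theorem exists_mul_norm_pow_le_eval {p : MvPolynomial (Fin n) ℝ} {k : ℕ} (hp : p.IsHomogeneous k)
    (hk : k ≠ 0) (hpos : ∀ x : Fin n → ℝ, x ≠ 0 → 0 < eval x p) :
    ∃ c, 0 < c ∧ ∀ x, c * ‖x‖ ^ k ≤ eval x p := by
  have hcpt : IsCompact (Metric.sphere (0 : Fin n → ℝ) 1) := isCompact_sphere 0 1
  obtain ⟨c, hc, hle⟩ : ∃ c, 0 < c ∧ ∀ x ∈ Metric.sphere (0 : Fin n → ℝ) 1, c ≤ eval x p := by
    rcases (Metric.sphere (0 : Fin n → ℝ) 1).eq_empty_or_nonempty with h | h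
    · exact ⟨1, one_pos, fun x hx => by rw [h] at hx; exact hx.elim⟩
    · obtain ⟨x₀, hx₀, hmin⟩ := hcpt.exists_isMinOn h (MvPolynomial.continuous_eval p).continuousOn
      exact ⟨_, hpos x₀ (ne_zero_of_mem_unit_sphere ⟨x₀, hx₀⟩), fun x hx => hmin hx⟩
  refine ⟨c, hc, fun x => ?_⟩
  rcases eq_or_ne x 0 with rfl | hx
  · have h0 := eval_smul_of_isHomogeneous hp 0 (0 : Fin n → ℝ)
    rw [zero_smul, zero_pow hk, zero_mul] at h0
    rw [norm_zero, zero_pow hk, mul_zero, h0]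
  · have hx' : 0 < ‖x‖ := norm_pos_iff.2 hx
    have h := hle (‖x‖⁻¹ • x) (by
      rw [mem_sphere_zero_iff_norm, norm_smul, norm_inv, norm_norm, inv_mul_cancel₀ hx'.ne'])
    rw [eval_smul_of_isHomogeneous hp, inv_pow, le_inv_mul_iff₀ (by positivity)] at h
    linarith

/-- Each edge of the walk contributes a factor `γ ^ (2 * d)`, since sums of squares are nonnegative.
The node `v` is the end of the walk. -/
theorem eval_pathProd_le [Fintype V] {G : LabelledGraph V (Fin m)}
    {A : Fin m → Matrix (Fin n) (Fin n) ℝ} {d : ℕ} {p : V → MvPolynomial (Fin n) ℝ} {γ : ℝ}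
    (hp : SOSFeasible G A d p γ) (s : List (V × V × Fin m)) :
    ∀ u, s ∈ G.walks u → ∃ v, ∀ x : Fin n → ℝ,
      eval (LabelledGraph.pathProd A s *ᵥ x) (p v) ≤ (γ ^ (2 * d)) ^ s.length * eval x (p u) := by
  induction s with
  | nil => exact fun u _ => ⟨u, fun x => by simp [LabelledGraph.pathProd_nil]⟩
  | cons e s ih =>
    intro u hs
    obtain ⟨he, rfl, hs'⟩ := G.cons_mem_walks.1 hs
    obtain ⟨v, hv⟩ := ih _ hs'
    refine ⟨v, fun x => ?_⟩
    have h1 := eval_nonneg_of_isSumSq (hp.sos_edge e.1 e.2.1 e.2.2 he) x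
    rw [map_sub, map_mul, eval_C, eval_substLinear, sub_nonneg] at h1
    have h2 := hv (A e.2.2 *ᵥ x)
    rw [Matrix.mulVec_mulVec, ← LabelledGraph.pathProd_cons] at h2
    refine h2.trans ((mul_le_mul_of_nonneg_left h1
      (pow_nonneg (pow_nonneg hp.nonneg _) _)).trans_eq ?_)
    rw [List.length_cons, pow_succ]
    ring

/-- Every feasible value of the program bounds the constrained joint spectral radius. -/
theorem cjsr_le_of_mem_sosValues [Fintype V] [Nonempty V] (hN : ∀ M, N M = 0 → M = 0) {d : ℕ}
    (hd : 1 ≤ d) {γ : ℝ} (hγ : γ ∈ sosValues G A d) : cjsr N G A ≤ γ := by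
  obtain ⟨p, hp⟩ := hγ
  have hγ0 := hp.nonneg
  choose c hc hcle using fun v =>
    exists_mul_norm_pow_le_eval (hp.homogeneous v) (by omega) (hp.pos v)
  -- A sum of nonnegative terms bounds each of them, uniformly in both ends of the path and the
  -- column.
  set R : ℝ := ∑ v, ∑ u, ∑ j : Fin n, (c v)⁻¹ * eval (Pi.single j 1) (p u) with hR
  have hterm : ∀ v u (j : Fin n), 0 ≤ (c v)⁻¹ * eval (Pi.single j 1) (p u) := fun v u j =>
    mul_nonneg (inv_nonneg.2 (hc v).le) (eval_nonneg_of_isSumSq (hp.sos_node u) _)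
  have hRle : ∀ v u (j : Fin n), (c v)⁻¹ * eval (Pi.single j 1) (p u) ≤ R := fun v u j =>
    (Finset.single_le_sum (f := fun j => (c v)⁻¹ * eval (Pi.single j 1) (p u))
      (fun j _ => hterm v u j) (Finset.mem_univ j)).trans
    ((Finset.single_le_sum (f := fun u => ∑ j : Fin n, (c v)⁻¹ * eval (Pi.single j 1) (p u))
      (fun u _ => Finset.sum_nonneg fun j _ => hterm v u j) (Finset.mem_univ u)).trans
    (Finset.single_le_sum (f := fun v => ∑ u, ∑ j : Fin n, (c v)⁻¹ * eval (Pi.single j 1) (p u))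
      (fun v _ => Finset.sum_nonneg fun u _ => Finset.sum_nonneg fun j _ => hterm v u j)
      (Finset.mem_univ v)))
  -- A base at least `1` is bounded by its `2 * d`-th power, so `|R| + 1` can replace the root of
  -- `R`.
  have h1R : (1 : ℝ) ≤ |R| + 1 := by linarith [abs_nonneg R]
  refine cjsr_le_of_forall_abs_entry_le N G A hN (C := |R| + 1) (by positivity) hγ0
    fun k w hw i j => ?_
  obtain ⟨u, s, hs, rfl, rfl⟩ := G.exists_mem_walks_of_mem_words hw
  obtain ⟨v, hv⟩ := eval_pathProd_le hp s u hs
  rw [wordProd_map_label]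
  set M := LabelledGraph.pathProd A s
  have hent : |M i j| ≤ ‖M *ᵥ Pi.single j 1‖ := by
    have := norm_le_pi_norm (M *ᵥ Pi.single j 1) i
    rwa [congrFun (Matrix.mulVec_single_one M j) i, Matrix.col_apply, Real.norm_eq_abs] at this
  refine hent.trans (le_of_pow_le_pow_left₀ (n := 2 * d) (by omega) (by positivity) ?_)
  have h := (hcle v _).trans (hv (Pi.single j 1))
  rw [mul_comm, ← le_div_iff₀ (hc v)] at h
  refine h.trans ?_
  calc (γ ^ (2 * d)) ^ s.length * eval (Pi.single j 1) (p u) / c v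
      = (γ ^ (2 * d)) ^ s.length * ((c v)⁻¹ * eval (Pi.single j 1) (p u)) := by
        rw [div_eq_mul_inv]; ring
    _ ≤ (γ ^ (2 * d)) ^ s.length * (|R| + 1) ^ (2 * d) := by
        refine mul_le_mul_of_nonneg_left ?_ (by positivity)
        calc _ ≤ R := hRle v u j
          _ ≤ |R| + 1 := by linarith [le_abs_self R]
          _ ≤ _ := le_self_pow₀ h1R (by omega)
    _ = ((|R| + 1) * γ ^ s.length) ^ (2 * d) := by
        rw [mul_pow, ← pow_mul, ← pow_mul, mul_comm (2 * d)]
        ring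

/-- Feasibility is known only strictly above the spectral radius; let `g` decrease to it. -/
theorem sosBound_le_mul_cjsr [Fintype V] {d : ℕ} {b : ℝ}
    (h : ∀ g, cjsr N G A < g → b * g ∈ sosValues G A d) :
    sosBound G A d ≤ b * cjsr N G A := by
  have hbdd : BddBelow (sosValues G A d) := ⟨0, by rintro γ ⟨p, hp⟩; exact hp.nonneg⟩
  have hlim : Tendsto (fun g => b * g) (𝓝[>] cjsr N G A) (𝓝 (b * cjsr N G A)) :=
    ((continuous_const.mul continuous_id).tendsto _).mono_left nhdsWithin_le_nhds
  refine ge_of_tendsto hlim ?_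
  filter_upwards [self_mem_nhdsWithin] with g hg
  exact csInf_le hbdd (h g hg)

end CJSR

/-! ### The main theorem -/

theorem mainTheorem4 {V : Type*} [Fintype V] {m n : ℕ} (hn : 1 ≤ n)
    (G : LabelledGraph V (Fin m)) (hG : G.StronglyConnected) (hE : G.edges.Nonempty)
    (A : Fin m → Matrix (Fin n) (Fin n) ℝ)
    (N : Seminorm ℝ (Matrix (Fin n) (Fin n) ℝ)) (hN : ∀ M, N M = 0 → M = 0)
    (d : ℕ) (hd : 1 ≤ d) :
    Filter.Tendsto (CJSR.cjsrSeq N G A) Filter.atTop (nhds (CJSR.cjsr N G A)) ∧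
    Filter.Tendsto G.edgeShift.entropySeq Filter.atTop (nhds G.edgeShift.entropy) ∧
    (CJSR.sosValues G A d).Nonempty ∧
    max (((n + d - 1).choose d : ℝ) ^ (-(1 / (2 * (d : ℝ)))))
        ((2 : ℝ) ^ (-(G.edgeShift.entropy / (2 * (d : ℝ))))) * CJSR.sosBound G A d
      ≤ CJSR.cjsr N G A ∧
    CJSR.cjsr N G A ≤ CJSR.sosBound G A d := by
  have : Nonempty V := ⟨hE.some.1⟩
  have hd0 : (0 : ℝ) < 2 * d := by positivity
  have hchoose : (0 : ℝ) < ((n + d - 1).choose d : ℝ) := by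
    exact_mod_cast Nat.choose_pos (by omega)
  have hJohn := fun g => CJSR.choose_rpow_mul_mem_sosValues N G A hn hN hd (g := g)
  have hne : (CJSR.sosValues G A d).Nonempty := ⟨_, hJohn _ (lt_add_one _)⟩
  have hsos0 : 0 ≤ CJSR.sosBound G A d := Real.sInf_nonneg (by rintro γ ⟨p, hp⟩; exact hp.nonneg)
  have h₁ := CJSR.sosBound_le_mul_cjsr N G A hJohn
  have h₂ : CJSR.sosBound G A d ≤
      (2 : ℝ) ^ (G.edgeShift.entropy / (2 * (d : ℝ))) * CJSR.cjsr N G A := by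
    -- The path count needs `h` strictly above the entropy; continuity in `h` gives the bound at the
    -- entropy itself.
    have hcont : Continuous fun h : ℝ => (2 : ℝ) ^ (h / (2 * (d : ℝ))) * CJSR.cjsr N G A := by
      have : Continuous fun h : ℝ => (2 : ℝ) ^ h := Real.continuous_const_rpow (by norm_num)
      fun_prop
    refine ge_of_tendsto ((hcont.tendsto G.edgeShift.entropy).mono_left
      (nhdsWithin_le_nhds (s := Set.Ioi G.edgeShift.entropy))) ?_
    filter_upwards [self_mem_nhdsWithin] with h hh
    refine CJSR.sosBound_le_mul_cjsr N G A fun g hg => ?_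
    have := CJSR.two_rpow_mul_mem_sosValues N G A hn hG hE hN hd hg hh
    rwa [← Real.rpow_mul (by norm_num), mul_one_div] at this
  refine ⟨CJSR.tendsto_cjsrSeq N G A hN, G.edgeShift.tendsto_entropySeq, hne, ?_,
    le_csInf hne fun γ hγ => CJSR.cjsr_le_of_mem_sosValues N G A hN hd hγ⟩
  rw [max_mul_of_nonneg _ _ hsos0, Real.rpow_neg hchoose.le, Real.rpow_neg (by norm_num)]
  exact max_le ((inv_mul_le_iff₀ (by positivity)).2 h₁) ((inv_mul_le_iff₀ (by positivity)).2 h₂)
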